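/- **Definitions.** All graphs are finite and simple. For a graph $G$ and disjoint nonempty $A,B\subseteq V(G)$ let $d(A,B)=\frac{e(A,B)}{|A||B|}$, where $e(A,B)$ is the number of edges between $A$ and $B$. The pair $(A,B)$ is *$\varepsilon$-regular* if $|d(X,Y)-d(A,B)|<\varepsilon$ for all $X\subseteq A$, $Y\subseteq B$ with $|X|>\varepsilon|A|$ and $|Y|>\varepsilon|B|$. An *$(\varepsilon,\eta)$-regular partition* of $G$ is a partition $V(G)=V_1\cup\dots\cup V_\ell$ into nonempty parts (*clusters*) such that $|V_1|=\dots=|V_\ell|$, each $V_i$ is independent in $G$, and for all $1\le i<j\le\ell$ the pair $(V_i,V_j)$ is $\varepsilon$-regular with $d(V_i,V_j)>\eta$ or $d(V_i,V_j)=0$. The corresponding *$(\varepsilon,\eta)$-reduced graph* $R$ has the clusters as its vertices, with $V_iV_j$ an edge ($i\ne j$) if and only if $d(V_i,V_j)>\eta$; $|R|=\ell$ denotes its number of vertices. $\delta(G)$ denotes the minimum degree of $G$. **Proposition.** For all $\alpha\in[\tfrac12,1)$, $\varepsilon\in(0,10^{-8})$ and $M_0\in\mathbb N$ there exists $k_0\in\mathbb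 N$ such that for all $n,k\ge k_0$ the following holds. Let $G$ be an $n$-vertex graph with $\delta(G)\ge(1+100\sqrt\varepsilon)\,\alpha k$ that has a connected $(\varepsilon,5\sqrt\varepsilon)$-reduced graph $R$ with $|R|\le M_0$. If (a) $R$ is bipartite with bipartition classes $A,B$ such that $|A|\ge(1+100\sqrt\varepsilon)\,k\cdot\frac{|R|}{n}$; or (b) $R$ is non-bipartite and $n\ge(1+100\sqrt\varepsilon)\,k$; then $G$ contains, as a (not necessarily induced) subgraph, every tree with $k$ edges and maximum degree at most $k^{1/c}$, where $c=18\lceil\tfrac2\alpha\rceil-5$. -/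

import Mathlib

namespace TreeEmbedding

/-- The pair `(A, B)` of vertex sets is `ε`-regular in `G`: for all `X ⊆ A`, `Y ⊆ B` with
`|X| > ε |A|` and `|Y| > ε |B|` one has `|d(X, Y) - d(A, B)| < ε`, where
`d(X, Y) = e(X, Y) / (|X| |Y|)`.  (Mathlib's `SimpleGraph.IsUniform` has non-strict size
conditions, hence is slightly stronger.) -/
def IsRegularPair {V : Type*} (G : SimpleGraph V) [DecidableRel G.Adj] (ε : ℝ)
    (A B : Finset V) : Prop :=
  ∀ X ⊆ A, ∀ Y ⊆ B, ε * (A.card : ℝ) < (X.card : ℝ) → ε * (B.card : ℝ) < (Y.card : ℝ) →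
    |(G.edgeDensity X Y : ℝ) - (G.edgeDensity A B : ℝ)| < ε

/-- An `(ε, η)`-regular partition of the vertex set of `G`. -/
structure IsRegularPartition {V : Type*} [Fintype V] [DecidableEq V] (G : SimpleGraph V)
    [DecidableRel G.Adj] (ε η : ℝ) (P : Finpartition (Finset.univ : Finset V)) : Prop where
  /-- All clusters have the same size. -/
  card_eq : ∀ C ∈ P.parts, ∀ D ∈ P.parts, C.card = D.card
  /-- Every cluster is an independent set. -/
  indep : ∀ C ∈ P.parts, ∀ x ∈ C, ∀ y ∈ C, ¬ G.Adj x y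
  /-- Every pair of distinct clusters is `ε`-regular. -/
  regular : ∀ C ∈ P.parts, ∀ D ∈ P.parts, C ≠ D → IsRegularPair G ε C D
  /-- Every pair of distinct clusters has density larger than `η`, or zero. -/
  density : ∀ C ∈ P.parts, ∀ D ∈ P.parts, C ≠ D →
    η < (G.edgeDensity C D : ℝ) ∨ (G.edgeDensity C D : ℝ) = 0

/-- The reduced graph with threshold `η` of a partition: its vertices are the clusters, and two
distinct clusters are adjacent if and only if their density is larger than `η`. -/
def reducedGraph {V : Type*} [Fintype V] [DecidableEq V] (G : SimpleGraph V)
    [DecidableRel G.Adj] (η : ℝ) (P : Finpartition (Finset.univ : Finset V)) :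
    SimpleGraph {C : Finset V // C ∈ P.parts} where
  Adj C D := C ≠ D ∧ η < (G.edgeDensity C.1 D.1 : ℝ)
  symm := ⟨fun C D h => ⟨h.1.symm, by rw [G.edgeDensity_comm]; exact h.2⟩⟩
  loopless := ⟨fun _ h => h.1 rfl⟩

end TreeEmbedding

namespace TreeEmbedding

open Finset

/-! Let `m` be the cluster size and `q` the least number of clusters with total size at least `(1 +
100√ε)k`. Neighbours of a vertex lie only in clusters adjacent to its own in `R`, and `α ≥ 1/2`, so
every degree in `R` is at least `q / 2`. The tree is cut into connected pieces of at most about `εm`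
vertices. It is then mapped homomorphically to `R` without overloading a cluster, and this map is
followed when embedding into `G`.

Room for the pieces is found within bounded distance of one cluster `c` (`exists_local_structure`).
If no edge near `c` joins two clusters at equal distance from `c`, the even levels near `c` form an
independent set of at least `q` clusters. The larger colour class of the tree is spread over it, and
the smaller class over the neighbourhoods. Otherwise there is a short odd closed walk through `c`,
and a deficiency form of Hall's theorem gives an injection `f` from at least `q` clusters to
neighbours. Pieces are placed on the edges `x, f x` with orientations balancing the two ends.

Consecutive pieces may sit on different edges of `R`, so the first 44 levels of a piece travel from
one edge to the next (`exists_routing`). The route lives in the bipartite double cover of `R` near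
`c`, which keeps track of parity. With maximum degree at most `k^(1/49)` these levels contain few
vertices. This is where the degree bound is needed.

For the embedding (`exists_embedding`) a small set `S` is reserved in each cluster for the roots of
pieces. Every image keeps many neighbours in `S`, so later pieces can be attached to it however full
the clusters become outside `S`. -/

/-- A rooted tree, given by its parent function and a depth function. -/
structure RootedTree (W : Type*) where
  /-- The root. -/
  root : W
  /-- The parent of a vertex; the root is its own parent. -/
  par : W → W
  /-- The depth of a vertex. -/
  dep : W → ℕ
  par_root : par root = root
  dep_par : ∀ v, v ≠ root → dep v = dep (par v) + 1

/-! ### Rooted trees and their decomposition into small connected pieces. -/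

namespace RootedTree

variable {W β : Type*}

open Classical in
/-- The function on a rooted tree that is defined recursively from the root downwards. -/
noncomputable def fold (t : RootedTree W) (x₀ : β) (F : W → β → β) (v : W) : β :=
  if _h : v = t.root then x₀ else F (t.par v) (t.fold x₀ F (t.par v))
termination_by t.dep v
decreasing_by have := t.dep_par v ‹_›; omega

lemma fold_root (t : RootedTree W) (x₀ : β) (F : W → β → β) : t.fold x₀ F t.root = x₀ := by
  rw [fold]; simp

lemma fold_of_ne (t : RootedTree W) (x₀ : β) (F : W → β → β) {v : W} (h : v ≠ t.root) :
    t.fold x₀ F v = F (t.par v) (t.fold x₀ F (t.par v)) := by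
  rw [fold]; simp [h]

lemma induct (t : RootedTree W) {p : W → Prop} (h₀ : p t.root)
    (h : ∀ v, v ≠ t.root → p (t.par v) → p v) (v : W) : p v := by
  induction hn : t.dep v using Nat.strong_induction_on generalizing v with
  | _ n ih =>
    by_cases hv : v = t.root
    · exact hv ▸ h₀
    · have := t.dep_par v hv
      exact h v hv (ih _ (by omega) _ rfl)

lemma iterate_par_root (t : RootedTree W) (j : ℕ) : t.par^[j] t.root = t.root :=
  Function.iterate_fixed t.par_root j

lemma exists_iterate_par_eq_root (t : RootedTree W) (v : W) : ∃ j, t.par^[j] v = t.root :=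
  t.induct (p := fun v => ∃ j, t.par^[j] v = t.root) ⟨0, rfl⟩
    (fun _ _ ⟨j, hj⟩ => ⟨j + 1, hj⟩) v

variable [Fintype W] [DecidableEq W]

/-- The children of a vertex. -/
def children (t : RootedTree W) (u : W) : Finset W := {v | v ≠ t.root ∧ t.par v = u}

open Classical in
/-- The descendants of `v` inside `X`. -/
noncomputable def desc (t : RootedTree W) (X : Finset W) (v : W) : Finset W :=
  {w ∈ X | ∃ j, t.par^[j] w = v}

lemma mem_desc {t : RootedTree W} {X : Finset W} {v w : W} :
    w ∈ t.desc X v ↔ w ∈ X ∧ ∃ j, t.par^[j] w = v := by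
  simp [desc]

lemma desc_subset (t : RootedTree W) (X : Finset W) (hX : ∀ v ∈ X, t.par v ∈ X) (v : W) :
    t.desc X v ⊆ insert v ((t.children v ∩ X).biUnion (t.desc X)) := by
  intro w hw
  obtain ⟨hwX, j, hj⟩ := mem_desc.1 hw
  clear hw
  induction j generalizing w with
  | zero => simp_all
  | succ j ih =>
    rw [Function.iterate_succ_apply] at hj
    have := ih (hX w hwX) hj
    rw [mem_insert, mem_biUnion] at this ⊢
    rcases this with h | ⟨c, hc, h⟩
    · by_cases hr : w = t.root
      · left; rw [hr, t.par_root] at h; rw [hr, h]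
      · exact Or.inr ⟨w, by simp [children, hr, h, hwX], mem_desc.2 ⟨hwX, 0, rfl⟩⟩
    · obtain ⟨-, i, hi⟩ := mem_desc.1 h
      exact Or.inr ⟨c, hc, mem_desc.2 ⟨hwX, i + 1, hi⟩⟩

lemma card_desc_le (t : RootedTree W) {D s : ℕ} (hD : ∀ u, #(t.children u) ≤ D) (X : Finset W)
    (hX : ∀ v ∈ X, t.par v ∈ X) (v : W)
    (h : ∀ c ∈ X, c ≠ t.root → t.par c = v → #(t.desc X c) ≤ s) :
    #(t.desc X v) ≤ 1 + D * s := by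
  calc #(t.desc X v) ≤ #(insert v ((t.children v ∩ X).biUnion (t.desc X))) :=
        card_le_card (t.desc_subset X hX v)
    _ ≤ #((t.children v ∩ X).biUnion (t.desc X)) + 1 := card_insert_le _ _
    _ ≤ #(t.children v ∩ X) * s + 1 := by
        gcongr
        refine card_biUnion_le_card_mul _ _ _ fun c hc => ?_
        simp only [children, mem_inter, mem_filter, mem_univ, true_and] at hc
        exact h c hc.2 hc.1.1 hc.1.2
    _ ≤ D * s + 1 := by
        gcongr
        exact (card_le_card inter_subset_left).trans (hD v)
    _ = _ := by ring

/-- A partition of the part `X` of a rooted tree into connected pieces: `Z` is the set of the roots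
of the pieces, and `pc v` is the root of the piece of `v`. -/
structure IsPieces (t : RootedTree W) (X Z : Finset W) (pc : W → W) : Prop where
  root_mem : t.root ∈ Z
  subset : Z ⊆ X
  pc_mem : ∀ v ∈ X, pc v ∈ Z
  pc_self : ∀ z ∈ Z, pc z = z
  pc_par : ∀ v ∈ X, v ∉ Z → pc v = pc (t.par v)

/-- Cut off the subtree at a deepest non-root vertex having more than `s` descendants in `X`. By
maximality the subtrees at its children have at most `s` vertices, so the part cut off has at most
`1 + D * s`. The rest of `X` is again closed under parents. -/
lemma exists_isPieces_aux (t : RootedTree W) {D s : ℕ} (hD : ∀ u, #(t.children u) ≤ D)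
    (n : ℕ) : ∀ X : Finset W, #X = n → t.root ∈ X → (∀ v ∈ X, t.par v ∈ X) →
    ∃ Z pc, t.IsPieces X Z pc ∧ #Z * s ≤ #X + s ∧ ∀ z ∈ Z, #{v ∈ X | pc v = z} ≤ 1 + D * s := by
  induction n using Nat.strong_induction_on with
  | _ n ih =>
  intro X hXn hroot hX
  by_cases hc : ∃ v ∈ X, v ≠ t.root ∧ s < #(t.desc X v)
  · have hne : (X.filter fun v => v ≠ t.root ∧ s < #(t.desc X v)).Nonempty := by
      obtain ⟨v, hv⟩ := hc
      exact ⟨v, by simpa using hv⟩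
    obtain ⟨v, hv, hmax⟩ := exists_max_image _ t.dep hne
    simp only [mem_filter] at hv hmax
    obtain ⟨hvX, hvr, hvs⟩ := hv
    have hbound : #(t.desc X v) ≤ 1 + D * s := by
      refine t.card_desc_le hD X hX v fun c hcX hcr hcv => ?_
      by_contra! hcon
      have h1 := hmax c ⟨hcX, hcr, hcon⟩
      have h2 := t.dep_par c hcr
      rw [hcv] at h2
      omega
    have hsub : t.desc X v ⊆ X := fun w hw => (mem_desc.1 hw).1
    have hvS : v ∈ t.desc X v := mem_desc.2 ⟨hvX, 0, rfl⟩
    have hcard : #(X \ t.desc X v) + #(t.desc X v) = #X := card_sdiff_add_card_eq_card hsub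
    have hup : ∀ w ∈ X, t.par w ∈ t.desc X v → w ∈ t.desc X v := by
      intro w hw h
      obtain ⟨-, j, hj⟩ := mem_desc.1 h
      exact mem_desc.2 ⟨hw, j + 1, hj⟩
    have hdown : ∀ w ∈ t.desc X v, w ≠ v → t.par w ∈ t.desc X v := by
      intro w hw hwv
      obtain ⟨hwX, j, hj⟩ := mem_desc.1 hw
      cases j with
      | zero => exact absurd hj hwv
      | succ j => exact mem_desc.2 ⟨hX w hwX, j, hj⟩
    have hrS : t.root ∉ t.desc X v := by
      intro h
      obtain ⟨-, j, hj⟩ := mem_desc.1 h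
      rw [t.iterate_par_root] at hj
      exact hvr hj.symm
    obtain ⟨Z, pc, hP, hZ, hsize⟩ := ih #(X \ t.desc X v)
      (by have := card_pos.2 ⟨v, hvS⟩; omega) (X \ t.desc X v) rfl
      (mem_sdiff.2 ⟨hroot, hrS⟩)
      (fun w hw => by
        rw [mem_sdiff] at hw ⊢
        exact ⟨hX w hw.1, fun h => hw.2 (hup w hw.1 h)⟩)
    have hZS : ∀ z ∈ Z, z ∉ t.desc X v := fun z hz => (mem_sdiff.1 (hP.subset hz)).2
    have hvZ : v ∉ Z := fun h => hZS v h hvS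
    refine ⟨insert v Z, fun w => if w ∈ t.desc X v then v else pc w,
      ⟨mem_insert_of_mem hP.root_mem, ?_, ?_, ?_, ?_⟩, ?_, ?_⟩
    · intro w hw
      rcases mem_insert.1 hw with rfl | hw
      · exact hvX
      · exact (mem_sdiff.1 (hP.subset hw)).1
    · intro w hw
      by_cases h : w ∈ t.desc X v
      · simp [h]
      · simp only [h, if_false]
        exact mem_insert_of_mem (hP.pc_mem w (mem_sdiff.2 ⟨hw, h⟩))
    · intro z hz
      rcases mem_insert.1 hz with rfl | hz
      · simp [hvS]
      · simp [hZS z hz, hP.pc_self z hz]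
    · intro w hw hwZ
      rw [mem_insert, not_or] at hwZ
      by_cases h : w ∈ t.desc X v
      · simp [h, hdown w h hwZ.1]
      · have h' : t.par w ∉ t.desc X v := fun h' => h (hup w hw h')
        simp only [h, h', if_false]
        exact hP.pc_par w (mem_sdiff.2 ⟨hw, h⟩) hwZ.2
    -- The more than `s` vertices removed pay for the new root `v`.
    · rw [card_insert_of_notMem hvZ]
      nlinarith
    · intro z hz
      rcases mem_insert.1 hz with rfl | hz
      · refine (card_le_card fun w hw => ?_).trans hbound
        rw [mem_filter] at hw
        by_contra h
        simp only [h, if_false] at hw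
        exact hvZ (hw.2 ▸ hP.pc_mem w (mem_sdiff.2 ⟨hw.1, h⟩))
      · refine (card_le_card fun w hw => ?_).trans (hsize z hz)
        rw [mem_filter] at hw
        have hzv : z ≠ v := fun h => hvZ (h ▸ hz)
        by_cases h : w ∈ t.desc X v
        · simp only [h, if_true] at hw
          exact absurd hw.2.symm hzv
        · simp only [h, if_false] at hw
          exact mem_filter.2 ⟨mem_sdiff.2 ⟨hw.1, h⟩, hw.2⟩
  · push Not at hc
    have hXr : X ⊆ t.desc X t.root := fun w hw =>
      mem_desc.2 ⟨hw, t.exists_iterate_par_eq_root w⟩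
    have hX1 : #X ≤ 1 + D * s := (card_le_card hXr).trans
      (t.card_desc_le hD X hX _ fun c hcX hcr _ => hc c hcX hcr)
    refine ⟨{t.root}, fun _ => t.root, ⟨by simp, by simpa using hroot, by simp, by simp,
      by simp⟩, by simp, fun z hz => ?_⟩
    exact (card_le_card (filter_subset _ _)).trans hX1

/-- Every rooted tree whose vertices have at most `D` children can be partitioned into connected
pieces of at most `1 + D * s` vertices each, all but one of which have more than `s` vertices. -/
lemma exists_isPieces (t : RootedTree W) {D : ℕ} (hD : ∀ u, #(t.children u) ≤ D) (s : ℕ) :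
    ∃ Z pc, t.IsPieces univ Z pc ∧ #Z * s ≤ Fintype.card W + s ∧
      ∀ z, #{v | pc v = z} ≤ 1 + D * s := by
  obtain ⟨Z, pc, hP, hZ, hs⟩ := t.exists_isPieces_aux hD (s := s) _ univ rfl (mem_univ _)
    (fun _ _ => mem_univ _)
  refine ⟨Z, pc, hP, by simpa using hZ, fun z => ?_⟩
  by_cases hz : z ∈ Z
  · exact hs z hz
  · have : ({v | pc v = z} : Finset W) = ∅ :=
      filter_eq_empty_iff.2 fun v _ h => hz (h ▸ hP.pc_mem v (mem_univ v))
    simp [this]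

variable {t : RootedTree W} {Z : Finset W} {pc : W → W}

lemma IsPieces.ne_root (h : t.IsPieces univ Z pc) {v : W} (hv : v ∉ Z) : v ≠ t.root :=
  fun e => hv (e ▸ h.root_mem)

lemma IsPieces.dep_pc_le (h : t.IsPieces univ Z pc) (v : W) : t.dep (pc v) ≤ t.dep v := by
  refine t.induct (p := fun v => t.dep (pc v) ≤ t.dep v) ?_ (fun v hv ih => ?_) v
  · rw [h.pc_self _ h.root_mem]
  · by_cases hz : v ∈ Z
    · rw [h.pc_self v hz]
    · rw [h.pc_par v (mem_univ v) hz]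
      have := t.dep_par v hv
      omega

lemma IsPieces.eq_pc_of_dep_le (h : t.IsPieces univ Z pc) {v : W} (hv : t.dep v ≤ t.dep (pc v)) :
    pc v = v := by
  by_cases hz : v ∈ Z
  · exact h.pc_self v hz
  · have h1 := t.dep_par v (h.ne_root hz)
    have h2 := h.dep_pc_le (t.par v)
    rw [← h.pc_par v (mem_univ v) hz] at h2
    omega

/-- A vertex of a piece other than its root has its parent in the same piece, so each level is at
most `D` times as large as the previous one. -/
lemma IsPieces.card_level_le (h : t.IsPieces univ Z pc) {D : ℕ}
    (hD : ∀ u, #(t.children u) ≤ D) (z : W) (j : ℕ) :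
    #{v | pc v = z ∧ t.dep v = t.dep z + j} ≤ D ^ j := by
  induction j with
  | zero =>
    rw [pow_zero, card_le_one]
    have key : ∀ v, pc v = z ∧ t.dep v = t.dep z + 0 → v = z := by
      rintro v ⟨rfl, h2⟩
      exact (h.eq_pc_of_dep_le h2.le).symm
    intro a ha b hb
    simp only [mem_filter, mem_univ, true_and] at ha hb
    rw [key a ha, key b hb]
  | succ j ih =>
    calc _ ≤ #(({v | pc v = z ∧ t.dep v = t.dep z + j} : Finset W).biUnion t.children) := by
          refine card_le_card fun v hv => ?_
          simp only [mem_filter, mem_univ, true_and] at hv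
          obtain ⟨rfl, hd⟩ := hv
          have hz : v ∉ Z := fun hz => by
            rw [h.pc_self v hz] at hd; omega
          have h1 := t.dep_par v (h.ne_root hz)
          rw [mem_biUnion]
          refine ⟨t.par v, ?_, by simp [children, h.ne_root hz]⟩
          simp only [mem_filter, mem_univ, true_and]
          exact ⟨(h.pc_par v (mem_univ v) hz).symm, by omega⟩
      _ ≤ #({v | pc v = z ∧ t.dep v = t.dep z + j} : Finset W) * D :=
          card_biUnion_le_card_mul _ _ _ fun u _ => hD u
      _ ≤ D ^ j * D := by gcongr
      _ = _ := (pow_succ D j).symm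

/-- The number of vertices that are at distance at most `L` from the root of their piece. -/
lemma IsPieces.card_shallow_le (h : t.IsPieces univ Z pc) {D : ℕ} (hD0 : 0 < D)
    (hD : ∀ u, #(t.children u) ≤ D) (L : ℕ) :
    #{v | t.dep v ≤ t.dep (pc v) + L} ≤ #Z * ((L + 1) * D ^ L) := by
  calc _ ≤ #(Z.biUnion fun z => (range (L + 1)).biUnion fun j =>
        ({v | pc v = z ∧ t.dep v = t.dep z + j} : Finset W)) := by
        refine card_le_card fun v hv => ?_
        simp only [mem_filter, mem_univ, true_and] at hv
        have := h.dep_pc_le v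
        simp only [mem_biUnion, mem_filter, mem_univ, true_and, mem_range]
        exact ⟨pc v, h.pc_mem v (mem_univ v), t.dep v - t.dep (pc v), by omega, rfl, by omega⟩
    _ ≤ _ := by
        refine card_biUnion_le_card_mul _ _ _ fun z _ => ?_
        refine (card_biUnion_le_card_mul _ _ (D ^ L) fun j hj => ?_).trans (by simp)
        refine (h.card_level_le hD z j).trans (Nat.pow_le_pow_right hD0 ?_)
        rw [mem_range] at hj
        omega

end RootedTree

/-- Every tree can be rooted. -/
lemma exists_rootedTree {W : Type*} {T : SimpleGraph W} (hT : T.IsTree) :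
    ∃ t : RootedTree W, (∀ v, v ≠ t.root → T.Adj (t.par v) v) ∧
      ∀ u v, T.Adj u v → (v ≠ t.root ∧ t.par v = u) ∨ (u ≠ t.root ∧ t.par u = v) := by
  obtain ⟨r⟩ := hT.connected.nonempty
  choose p hp hu using fun v => hT.existsUnique_path r v
  have hlen : ∀ v, (p v).length = T.dist r v := by
    intro v
    obtain ⟨q, hq, hl⟩ := hT.connected.exists_path_of_dist r v
    rw [← hl, hu v q hq]
  have hadj : ∀ v, v ≠ r → T.Adj (p v).penultimate v := fun v hv =>
    (p v).adj_penultimate (fun h => hv h.eq.symm)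
  have key : ∀ u v, T.Adj u v → T.dist r v = T.dist r u + 1 → v ≠ r ∧ (p v).penultimate = u := by
    intro u v huv hd
    have h1 : ((p u).concat huv).IsPath := by
      apply SimpleGraph.Walk.isPath_of_length_eq_dist
      rw [SimpleGraph.Walk.length_concat, hlen, hd]
    refine ⟨?_, ?_⟩
    · rintro rfl
      simp at hd
    · rw [← hu v _ h1, SimpleGraph.Walk.penultimate_concat]
  refine ⟨⟨r, fun v => (p v).penultimate, fun v => T.dist r v, ?_, ?_⟩, hadj, ?_⟩
  · have : p r = .nil := (hu r .nil (by simp)).symm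
    simp [this]
  · intro v hv
    rcases hT.dist_eq_dist_add_one_of_adj r (hadj v hv) with h | h
    · exfalso
      have h1 : T.dist r (p v).penultimate ≤ (p v).dropLast.length := SimpleGraph.dist_le _
      have h2 : (p v).dropLast.length ≤ (p v).length := by
        simp
      rw [hlen] at h2
      omega
    · exact h
  · intro u v huv
    rcases hT.dist_eq_dist_add_one_of_adj r huv with h | h
    · exact Or.inr (key v u huv.symm h)
    · exact Or.inl (key u v huv h)

/-! ### Greedy distribution of the pieces over edges of the reduced graph. -/

section Allocation

variable {ι κ : Type*} [DecidableEq ι]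

lemma exists_mem_load_lt {I : Finset κ} {a : κ → ℕ} {σ : κ → ι} {A : Finset ι} {m : ℕ}
    (h : ∑ i ∈ I, a i < #A * m) : ∃ x ∈ A, ∑ i ∈ I, (if σ i = x then a i else 0) < m := by
  apply exists_lt_of_sum_lt
  rw [sum_comm, sum_const, smul_eq_mul]
  refine lt_of_le_of_lt (sum_le_sum fun i _ => ?_) h
  rw [sum_ite_eq]
  split_ifs <;> simp

lemma sum_update_insert [DecidableEq κ] {γ : Type*} {i : κ} {I : Finset κ} (hi : i ∉ I)
    (σ : κ → γ) (v : γ) (w : κ → γ → ℕ) :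
    ∑ j ∈ insert i I, w j (Function.update σ i v j) = w i v + ∑ j ∈ I, w j (σ j) := by
  rw [sum_insert hi, Function.update_self]
  congr 1
  refine sum_congr rfl fun j hj => ?_
  have hji : j ≠ i := fun h => hi (by rwa [h] at hj)
  rw [Function.update_of_ne hji]

/-- Distribution of small pieces, each with a prescribed orientation, over the edges at an
independent set. -/
lemma exists_allocation_of_isIndep [Fintype ι] [DecidableEq κ] (R : SimpleGraph ι)
    [DecidableRel R.Adj] (I : Finset κ) (a b : κ → ℕ) {s m d : ℕ} (A : Finset ι)
    (hA : ∀ x ∈ A, ∀ y ∈ A, ¬ R.Adj x y) (has : ∀ i ∈ I, a i + b i ≤ s)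
    (hd : ∀ x ∈ A, d ≤ R.degree x) (ha : ∑ i ∈ I, a i < #A * m) (hb : ∑ i ∈ I, b i < d * m) :
    ∃ τ : κ → ι × ι, (∀ i ∈ I, (τ i).1 ∈ A ∧ R.Adj (τ i).1 (τ i).2) ∧
      ∀ x, ∑ i ∈ I, (if (τ i).1 = x then a i else 0) +
        ∑ i ∈ I, (if (τ i).2 = x then b i else 0) ≤ m + s := by
  have key : ∃ τ : κ → ι × ι, (∀ i ∈ I, (τ i).1 ∈ A ∧ R.Adj (τ i).1 (τ i).2) ∧
      ∀ x, ∑ i ∈ I, (if (τ i).1 = x then a i else 0) ≤ m + s ∧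
        ∑ i ∈ I, (if (τ i).2 = x then b i else 0) ≤ m + s := by
    induction I using Finset.induction_on with
    | empty =>
      obtain ⟨c, hc⟩ : A.Nonempty := by
        rw [← card_pos]
        by_contra! h
        simp_all
      exact ⟨fun _ => (c, c), by simp⟩
    | insert i I hi ih =>
      rw [sum_insert hi] at ha hb
      obtain ⟨τ, hτ, hload⟩ := ih (fun j hj => has j (mem_insert_of_mem hj)) (by omega) (by omega)
      obtain ⟨x, hx, hxl⟩ := exists_mem_load_lt (σ := fun j => (τ j).1)
        (lt_of_le_of_lt (Nat.le_add_left _ _) ha)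
      have hb' : ∑ j ∈ I, b j < #(R.neighborFinset x) * m :=
        lt_of_lt_of_le (lt_of_le_of_lt (Nat.le_add_left _ _) hb)
          (Nat.mul_le_mul_right _ (hd x hx))
      obtain ⟨y, hy, hyl⟩ := exists_mem_load_lt (σ := fun j => (τ j).2) hb'
      rw [SimpleGraph.mem_neighborFinset] at hy
      have hs := has i (mem_insert_self i I)
      refine ⟨Function.update τ i (x, y), ?_, ?_⟩
      · intro j hj
        by_cases hji : j = i
        · subst hji
          simp [hx, hy]
        · rw [Function.update_of_ne hji]
          exact hτ j ((mem_insert.1 hj).resolve_left hji)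
      · intro z
        rw [sum_update_insert hi τ (x, y) (fun j p => if p.1 = z then a j else 0),
          sum_update_insert hi τ (x, y) (fun j p => if p.2 = z then b j else 0)]
        obtain ⟨h1, h2⟩ := hload z
        constructor
        · by_cases h : x = z
          · subst h; simp only [if_true]; omega
          · simp only [h, if_false]; omega
        · by_cases h : y = z
          · subst h; simp only [if_true]; omega
          · simp only [h, if_false]; omega
  obtain ⟨τ, hτ, hload⟩ := key
  refine ⟨τ, hτ, fun x => ?_⟩
  -- Since `A` is independent, second ends lie outside `A`, so each vertex carries load from only
  -- one of `a` and `b`.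
  by_cases hx : x ∈ A
  · have : ∑ i ∈ I, (if (τ i).2 = x then b i else 0) = 0 := by
      refine sum_eq_zero fun i hi => if_neg ?_
      rintro rfl
      exact hA _ (hτ i hi).1 _ hx (hτ i hi).2
    rw [this]
    exact (hload x).1
  · have : ∑ i ∈ I, (if (τ i).1 = x then a i else 0) = 0 := by
      refine sum_eq_zero fun i hi => if_neg ?_
      rintro rfl
      exact hx (hτ i hi).1
    rw [this, zero_add]
    exact (hload x).2

/-- Distribution of small pieces, whose orientation can be chosen, over the directed edges
`(x, f x)` for an injective function `f`. -/
lemma exists_allocation_of_injOn [DecidableEq κ] (I : Finset κ) (a b : κ → ℕ) {s m : ℕ}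
    (J : Finset ι) (f : ι → ι) (hf : Set.InjOn f J) (has : ∀ i ∈ I, a i + b i ≤ s)
    (hab : ∑ i ∈ I, (a i + b i) < #J * (2 * m)) :
    ∃ τ : κ → ι × ι, (∀ i ∈ I, ∃ x ∈ J, τ i = (x, f x) ∨ τ i = (f x, x)) ∧
      ∀ x, ∑ i ∈ I, (if (τ i).1 = x then a i else 0) +
        ∑ i ∈ I, (if (τ i).2 = x then b i else 0) ≤ 2 * m + 4 * s := by
  -- For the pieces placed on the edge at `x`, `p` is the load at `x` and `q` the load at `f x`.
  -- They are kept within `s` of each other, so `p + q < 2 * m` bounds both.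
  have key : ∃ e : κ → ι × Bool, (∀ i ∈ I, (e i).1 ∈ J) ∧
      ∀ x, ∃ p q, p = ∑ i ∈ I, (if (e i).1 = x then (if (e i).2 then a i else b i) else 0) ∧
        q = ∑ i ∈ I, (if (e i).1 = x then (if (e i).2 then b i else a i) else 0) ∧
        p ≤ m + 2 * s ∧ q ≤ m + 2 * s ∧ p ≤ q + s ∧ q ≤ p + s := by
    induction I using Finset.induction_on with
    | empty =>
      obtain ⟨c, hc⟩ : J.Nonempty := by
        rw [← card_pos]
        by_contra! h
        simp_all
      exact ⟨fun _ => (c, true), by simp⟩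
    | insert i I hi ih =>
      rw [sum_insert hi] at hab
      obtain ⟨e, he, hload⟩ := ih (fun j hj => has j (mem_insert_of_mem hj)) (by omega)
      obtain ⟨x, hx, hxl⟩ := exists_mem_load_lt (σ := fun j => (e j).1)
        (lt_of_le_of_lt (Nat.le_add_left _ _) hab)
      have hs := has i (mem_insert_self i I)
      obtain ⟨p, q, hp, hq, hpm, hqm, hpq, hqp⟩ := hload x
      have hsum : p + q < 2 * m := by
        rw [hp, hq, ← sum_add_distrib]
        convert hxl using 3 with j hj
        split_ifs <;> omega
      obtain ⟨o, ho⟩ : ∃ o : Bool, p + (if o then a i else b i) ≤ m + 2 * s ∧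
          q + (if o then b i else a i) ≤ m + 2 * s ∧
          p + (if o then a i else b i) ≤ q + (if o then b i else a i) + s ∧
          q + (if o then b i else a i) ≤ p + (if o then a i else b i) + s := by
        -- The larger half of the piece goes to the less loaded end.
        by_cases h : (p ≤ q ∧ b i ≤ a i) ∨ (q ≤ p ∧ a i ≤ b i)
        · exact ⟨true, by simp only [if_true]; omega⟩
        · exact ⟨false, by simp only [Bool.false_eq_true, if_false]; omega⟩
      refine ⟨Function.update e i (x, o), ?_, ?_⟩
      · intro j hj
        by_cases hji : j = i
        · subst hji
          simp [hx]
        · rw [Function.update_of_ne hji]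
          exact he j ((mem_insert.1 hj).resolve_left hji)
      · intro z
        refine ⟨_, _, rfl, rfl, ?_⟩
        rw [sum_update_insert hi e (x, o)
            (fun j v => if v.1 = z then (if v.2 then a j else b j) else 0),
          sum_update_insert hi e (x, o)
            (fun j v => if v.1 = z then (if v.2 then b j else a j) else 0)]
        obtain ⟨p', q', hp', hq', h⟩ := hload z
        rw [← hp', ← hq']
        by_cases hz : x = z
        · subst hz
          rw [← hp] at hp'
          rw [← hq] at hq'
          subst hp' hq'
          simp only [if_true]
          omega
        · simpa only [hz, if_false, zero_add] using h
  obtain ⟨e, he, hload⟩ := key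
  refine ⟨fun i => if (e i).2 then ((e i).1, f (e i).1) else (f (e i).1, (e i).1), ?_, ?_⟩
  · intro i hi
    refine ⟨_, he i hi, ?_⟩
    by_cases h : (e i).2 <;> simp [h]
  · intro x
    have h1 : ∑ i ∈ I, (if (if (e i).2 then ((e i).1, f (e i).1) else
          (f (e i).1, (e i).1)).1 = x then a i else 0) +
        ∑ i ∈ I, (if (if (e i).2 then ((e i).1, f (e i).1) else
          (f (e i).1, (e i).1)).2 = x then b i else 0) =
        ∑ i ∈ I, (if (e i).1 = x then (if (e i).2 then a i else b i) else 0) +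
        ∑ i ∈ I, (if f (e i).1 = x then (if (e i).2 then b i else a i) else 0) := by
      rw [← sum_add_distrib, ← sum_add_distrib]
      refine sum_congr rfl fun i _ => ?_
      by_cases h : (e i).2
      · simp [h]
      · simp only [h, Bool.false_eq_true, if_false]
        exact add_comm _ _
    rw [h1]
    have h2 : ∑ i ∈ I, (if f (e i).1 = x then (if (e i).2 then b i else a i) else 0) ≤
        m + 2 * s := by
      -- By injectivity `x` is the second end of at most one edge, so its load comes from at most
      -- two edges.
      by_cases hy : ∃ y ∈ J, f y = x
      · obtain ⟨y, hy, rfl⟩ := hy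
        obtain ⟨p, q, -, hq, -, hqm, -⟩ := hload y
        rw [hq] at hqm
        convert hqm using 3 with i hi
        exact ⟨fun h => hf (he i hi) hy h, fun h => h ▸ rfl⟩
      · rw [sum_eq_zero]
        · exact Nat.zero_le _
        · intro i hi
          exact if_neg fun h => hy ⟨_, he i hi, h⟩
    obtain ⟨p, q, hp, -, hpm, -⟩ := hload x
    rw [← hp]
    omega

end Allocation

/-! ### Room for the tree near a vertex of the reduced graph. -/

section ReducedGraph

variable {ι : Type*} [Fintype ι] [DecidableEq ι] (R : SimpleGraph ι) [DecidableRel R.Adj]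

/-- In a graph of minimum degree at least `q / 2`, an injective function of at least `q` vertices
to neighbours; all vertices come from a set `I` that contains the neighbourhood of `q` vertices. -/
lemma exists_injOn_adj {q : ℕ} (hdeg : ∀ v, q ≤ 2 * R.degree v) (B I : Finset ι)
    (hBI : ∀ v ∈ B, R.neighborFinset v ⊆ I) (hI : q ≤ #I) (hB : q ≤ #B) :
    ∃ J ⊆ I, ∃ f : ι → ι, q ≤ #J ∧ Set.InjOn f J ∧ ∀ x ∈ J, R.Adj x (f x) := by
  -- Deficiency form of Hall's theorem: each neighbourhood is padded with `#I - q` common dummies,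
  -- so at least `q` vertices are matched to genuine neighbours.
  have hall := (Finset.all_card_le_biUnion_card_iff_exists_injective
    (fun x : I => (R.neighborFinset x.1).disjSum (univ : Finset (Fin (#I - q))))).1 ?_
  · obtain ⟨g, hg, hgt⟩ := hall
    classical
    let J' : Finset I := {x | (g x).isLeft}
    have hJ' : q ≤ #J' := by
      have h1 : #(univ.filter fun x : I => ¬ (g x).isLeft) ≤ #I - q := by
        calc _ ≤ #((univ : Finset (Fin (#I - q))).map ⟨Sum.inr, Sum.inr_injective⟩ :
              Finset (ι ⊕ Fin (#I - q))) := by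
              refine card_le_card_of_injOn g ?_ hg.injOn
              intro x hx
              simp only [coe_filter, mem_univ, true_and, Set.mem_ofPred_eq] at hx
              cases h : g x with
              | inl y => simp [h] at hx
              | inr y => simp
          _ = _ := by simp
      have h2 := card_filter_add_card_filter_not (s := (univ : Finset I))
        (fun x : I => (g x).isLeft)
      rw [card_univ, Fintype.card_coe] at h2
      have h3 : #J' = #(univ.filter fun x : I => (g x).isLeft) := rfl
      omega
    let f : ι → ι := fun x => if h : x ∈ I then (g ⟨x, h⟩).elim id (fun _ => x) else x
    have hf : ∀ x : I, x ∈ J' → g x = Sum.inl (f x) := by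
      intro x hx
      simp only [J', mem_filter, mem_univ, true_and] at hx
      simp only [f, x.2, dif_pos]
      cases h : g x with
      | inl y => simp
      | inr y => simp [h] at hx
    refine ⟨J'.map ⟨Subtype.val, Subtype.val_injective⟩, ?_, f, by simpa using hJ', ?_, ?_⟩
    · intro x hx
      simp only [mem_map, Function.Embedding.coeFn_mk] at hx
      obtain ⟨y, -, rfl⟩ := hx
      exact y.2
    · intro x hx y hy hxy
      simp only [coe_map, Function.Embedding.coeFn_mk, Set.mem_image, mem_coe] at hx hy
      obtain ⟨x, hx, rfl⟩ := hx
      obtain ⟨y, hy, rfl⟩ := hy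
      have := hg ((hf x hx).trans ((congrArg Sum.inl hxy).trans (hf y hy).symm))
      rw [this]
    · intro x hx
      simp only [mem_map, Function.Embedding.coeFn_mk] at hx
      obtain ⟨x, hx, rfl⟩ := hx
      have := hgt x
      rw [hf x hx, inl_mem_disjSum, SimpleGraph.mem_neighborFinset] at this
      exact this
  · intro S
    rcases S.eq_empty_or_nonempty with rfl | ⟨x, hx⟩
    · simp
    · have hsub : (S.biUnion fun x => R.neighborFinset x.1).disjSum
          (univ : Finset (Fin (#I - q))) ⊆
          S.biUnion fun x => (R.neighborFinset x.1).disjSum (univ : Finset (Fin (#I - q))) := by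
        intro y hy
        rw [mem_biUnion]
        cases y with
        | inl y => simpa using hy
        | inr y => exact ⟨x, hx, by simp⟩
      refine le_trans ?_ (card_le_card hsub)
      rw [card_disjSum, card_univ, Fintype.card_fin]
      have hxN : R.degree x.1 ≤ #(S.biUnion fun x => R.neighborFinset x.1) :=
        card_le_card fun y hy => mem_biUnion.2 ⟨x, hx, hy⟩
      have hx2 := hdeg x.1
      have hSI : #S ≤ #I := by simpa using card_le_univ S
      by_contra! hcon
      -- A `v ∈ B` without neighbours in `S` has its neighbourhood in `I \ S`; as the degrees of `v`
      -- and `x` sum to at least `q`, this contradicts `hcon`. Hence the neighbourhood of `S`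
      -- contains `B`, which is too large for `hcon`.
      have hBN : B ⊆ S.biUnion fun x => R.neighborFinset x.1 := by
        intro v hv
        by_contra hvN
        have hdisj : Disjoint (R.neighborFinset v)
            (S.map ⟨Subtype.val, Subtype.val_injective⟩) := by
          rw [disjoint_left]
          intro y hy hyS
          simp only [mem_map, Function.Embedding.coeFn_mk] at hyS
          obtain ⟨y, hyS, rfl⟩ := hyS
          refine hvN (mem_biUnion.2 ⟨y, hyS, ?_⟩)
          rw [SimpleGraph.mem_neighborFinset] at hy ⊢
          exact hy.symm
        have hle : #(R.neighborFinset v ∪ S.map ⟨Subtype.val, Subtype.val_injective⟩) ≤ #I := by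
          refine card_le_card (union_subset (hBI v hv) ?_)
          intro y hy
          simp only [mem_map, Function.Embedding.coeFn_mk] at hy
          obtain ⟨y, -, rfl⟩ := hy
          exact y.2
        rw [card_union_of_disjoint hdisj, card_map, SimpleGraph.card_neighborFinset_eq_degree] at hle
        have := hdeg v
        omega
      have := card_le_card hBN
      omega

variable {R}

lemma dist_le_succ_of_adj (hR : R.Connected) (c : ι) {x y : ι} (h : R.Adj x y) :
    R.dist c y ≤ R.dist c x + 1 := by
  have := hR.dist_triangle (u := c) (v := x) (w := y)
  rwa [SimpleGraph.dist_eq_one_iff_adj.2 h] at this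

/-- Discrete intermediate values: along a walk from `c` the distance grows by at most one per step.
-/
lemma exists_dist_eq (hR : R.Connected) (c : ι) {x : ι} {n : ℕ} (h : n ≤ R.dist c x) :
    ∃ y, R.dist c y = n := by
  obtain ⟨p, hp⟩ := hR.exists_walk_length_eq_dist c x
  clear hp
  induction p using SimpleGraph.Walk.concatRec with
  | Hnil =>
    rename_i u
    exact ⟨u, by simp at h; simp [h]⟩
  | Hconcat p hxy ih =>
    rename_i u v w
    have h1 := dist_le_succ_of_adj hR u hxy
    by_cases h2 : n = R.dist u w
    · exact ⟨w, h2.symm⟩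
    · exact ih (by omega)

/-- In a connected graph with minimum degree at least `q / 2`, either some independent set of size
`q` or an injective function of `q` vertices to neighbours is found near `c`. -/
lemma exists_local_structure (hR : R.Connected) {q : ℕ} (hdeg : ∀ v, q ≤ 2 * R.degree v)
    (hq : q ≤ Fintype.card ι) (c : ι)
    (hc : (∀ x y, R.Adj x y → R.dist c x % 2 ≠ R.dist c y % 2) →
      q ≤ #{x | R.dist c x % 2 = 0}) :
    (∃ A : Finset ι, q ≤ #A ∧ (∀ x ∈ A, ∀ y ∈ A, ¬ R.Adj x y) ∧
      ∀ x ∈ A, ∃ w : R.Walk x c, Even w.length ∧ w.length ≤ 21) ∨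
    ∃ (J : Finset ι) (f : ι → ι), q ≤ #J ∧ Set.InjOn f J ∧ (∀ x ∈ J, R.Adj x (f x)) ∧
      ∀ x ∈ J, (∃ w : R.Walk x c, Even w.length ∧ w.length ≤ 21) ∧
        ∃ w : R.Walk (f x) c, Even w.length ∧ w.length ≤ 21 := by
  have hwalk : ∀ x, ∃ w : R.Walk x c, w.length = R.dist c x := by
    intro x
    rw [SimpleGraph.dist_comm]
    exact hR.exists_walk_length_eq_dist x c
  have hadj : ∀ x y, R.Adj x y → R.dist c y ≤ R.dist c x + 1 ∧ R.dist c x ≤ R.dist c y + 1 :=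
    fun x y h => ⟨dist_le_succ_of_adj hR c h, dist_le_succ_of_adj hR c h.symm⟩
  have hnear : ∀ (S : Finset ι) (u w : ι), R.neighborFinset u ⊆ S → R.neighborFinset w ⊆ S →
      (∀ x, R.Adj u x → ¬ R.Adj w x) → q ≤ #S := by
    intro S u w hu hw huw
    have hd : Disjoint (R.neighborFinset u) (R.neighborFinset w) := by
      rw [disjoint_left]
      intro x hx
      rw [SimpleGraph.mem_neighborFinset] at hx ⊢
      exact huw x hx
    have h1 := card_le_card (union_subset hu hw)
    rw [card_union_of_disjoint hd, SimpleGraph.card_neighborFinset_eq_degree,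
      SimpleGraph.card_neighborFinset_eq_degree] at h1
    have := hdeg u
    have := hdeg w
    omega
  -- An edge inside a level closes an odd walk through `c` of length at most 13. Adding it corrects
  -- the parity of any short walk to `c`.
  by_cases hodd : ∃ x y, R.Adj x y ∧ R.dist c x = R.dist c y ∧ R.dist c x ≤ 6
  · right
    obtain ⟨x, y, hxy, hdist, hx6⟩ := hodd
    have heven : ∀ z, R.dist c z ≤ 6 → ∃ w : R.Walk z c, Even w.length ∧ w.length ≤ 21 := by
      intro z hz
      obtain ⟨w, hw⟩ := hwalk z
      rcases Nat.even_or_odd w.length with h | h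
      · exact ⟨w, h, by omega⟩
      · obtain ⟨wx, hwx⟩ := hwalk x
        obtain ⟨wy, hwy⟩ := hwalk y
        refine ⟨(w.append wx.reverse).append (.cons hxy wy), ?_, ?_⟩
        · simp only [SimpleGraph.Walk.length_append, SimpleGraph.Walk.length_reverse,
            SimpleGraph.Walk.length_cons]
          rw [Nat.even_iff]
          rw [Nat.odd_iff] at h
          omega
        · simp only [SimpleGraph.Walk.length_append, SimpleGraph.Walk.length_reverse,
            SimpleGraph.Walk.length_cons]
          omega
    -- The neighbourhoods of `c` and of a vertex at distance 3 are disjoint, and each has at least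
    -- `q / 2` vertices.
    have hB : q ≤ #(univ.filter fun z => R.dist c z ≤ 4) := by
      by_cases h3 : ∃ z, 3 ≤ R.dist c z
      · obtain ⟨z, hz⟩ := h3
        obtain ⟨w, hw⟩ := exists_dist_eq hR c hz
        refine hnear _ c w ?_ ?_ ?_
        · intro v hv
          rw [SimpleGraph.mem_neighborFinset] at hv
          have := hadj _ _ hv
          simp only [SimpleGraph.dist_self] at this
          simp only [mem_filter, mem_univ, true_and]
          omega
        · intro v hv
          rw [SimpleGraph.mem_neighborFinset] at hv
          have := hadj _ _ hv
          simp only [mem_filter, mem_univ, true_and]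
          omega
        · intro v h1 h2
          have h1 := hadj _ _ h1
          have h2 := hadj _ _ h2
          simp only [SimpleGraph.dist_self] at h1
          omega
      · push Not at h3
        rw [filter_true_of_mem fun z _ => by have := h3 z; omega]
        exact hq
    obtain ⟨J, hJ, f, hJq, hf, hJadj⟩ := exists_injOn_adj R hdeg
      (univ.filter fun z => R.dist c z ≤ 4) (univ.filter fun z => R.dist c z ≤ 5)
      (by
        intro v hv z hz
        rw [SimpleGraph.mem_neighborFinset] at hz
        have := hadj _ _ hz
        simp only [mem_filter, mem_univ, true_and] at hv ⊢
        omega)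
      (hB.trans (card_le_card fun z hz => by
        simp only [mem_filter, mem_univ, true_and] at hz ⊢
        omega)) hB
    refine ⟨J, f, hJq, hf, hJadj, fun z hz => ?_⟩
    have h5 := hJ hz
    simp only [mem_filter, mem_univ, true_and] at h5
    have := hadj _ _ (hJadj z hz)
    exact ⟨heven z (by omega), heven _ (by omega)⟩
  · left
    push Not at hodd
    refine ⟨univ.filter fun z => R.dist c z % 2 = 0 ∧ R.dist c z ≤ 6, ?_, ?_, ?_⟩
    -- Vertices at distances 1 and 5 have disjoint neighbourhoods in the even levels up to 6.
    -- Without a fifth level the whole graph has no edge inside a level, and `hc` applies.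
    · by_cases h5 : ∃ z, 5 ≤ R.dist c z
      · obtain ⟨z, hz⟩ := h5
        obtain ⟨w, hw⟩ := exists_dist_eq hR c hz
        obtain ⟨u, hu⟩ := exists_dist_eq hR c ((by omega : 1 ≤ 5).trans hz)
        have hN : ∀ y, (R.dist c y = 1 ∨ R.dist c y = 5) → R.neighborFinset y ⊆
            univ.filter fun z => R.dist c z % 2 = 0 ∧ R.dist c z ≤ 6 := by
          intro y hy v hv
          rw [SimpleGraph.mem_neighborFinset] at hv
          have h1 := hadj _ _ hv
          have h2 := hodd _ _ hv
          simp only [mem_filter, mem_univ, true_and]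
          omega
        refine hnear _ u w (hN u (Or.inl hu)) (hN w (Or.inr hw)) ?_
        intro v h1 h2
        have h1 := hadj _ _ h1
        have h2 := hadj _ _ h2
        omega
      · push Not at h5
        refine (hc fun x y hxy => ?_).trans (card_le_card fun z hz => ?_)
        · have h1 := hadj _ _ hxy
          have h2 := hodd _ _ hxy
          have h3 := h5 x
          omega
        · have h3 := h5 z
          simp only [mem_filter, mem_univ, true_and] at hz ⊢
          omega
    · intro x hx y hy hxy
      simp only [mem_filter, mem_univ, true_and] at hx hy
      have h1 := hadj _ _ hxy
      have h2 := hodd _ _ hxy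
      omega
    · intro x hx
      simp only [mem_filter, mem_univ, true_and] at hx
      obtain ⟨w, hw⟩ := hwalk x
      exact ⟨w, Nat.even_iff.2 (by omega), by omega⟩

end ReducedGraph

/-! ### Routing the tree through the reduced graph. -/

section Routing

variable {σ W : Type*}

/-- Iterating `step` follows a shortest path to `p` and then alternates between `p` and `q`. -/
lemma exists_step (H : SimpleGraph σ) (hH : H.Connected) {p q : σ} (hpq : H.Adj p q) :
    ∃ step : σ → σ, ∀ x, H.Adj x (step x) ∧ (x = p → step x = q) ∧
      (x ≠ p → H.dist (step x) p + 1 = H.dist x p) := by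
  refine Classical.axiomOfChoice (r := fun x y => H.Adj x y ∧ (x = p → y = q) ∧
    (x ≠ p → H.dist y p + 1 = H.dist x p)) fun x => ?_
  by_cases hx : x = p
  · exact ⟨q, by simp [hx, hpq]⟩
  · obtain ⟨w, hw⟩ := hH.exists_walk_length_eq_dist x p
    cases w with
    | nil => exact absurd rfl hx
    | @cons _ y _ h w =>
      refine ⟨y, h, fun h => absurd h hx, fun _ => ?_⟩
      have h1 := SimpleGraph.dist_le w
      have h2 := hH.dist_triangle (u := x) (v := y) (w := p)
      rw [SimpleGraph.dist_eq_one_iff_adj.2 h] at h2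
      rw [SimpleGraph.Walk.length_cons] at hw
      omega

/-- A homomorphism of a rooted tree to a bipartite graph `H` of diameter at most `L`, which maps all
vertices of a piece, except those close to the root of the piece, to the ends of a prescribed edge.
All children of a vertex have the same image. -/
lemma exists_routing [Fintype W] [DecidableEq W] (H : SimpleGraph σ) (hH : H.Connected) {L : ℕ}
    (hL : 0 < L) (hdist : ∀ x y, H.dist x y ≤ L) (κ : σ → Bool)
    (hκ : ∀ x y, H.Adj x y → κ y = !κ x) {t : RootedTree W} {Z : Finset W} {pc : W → W}
    (hP : t.IsPieces univ Z pc) (col : W → Bool)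
    (hcol : ∀ v, v ≠ t.root → col v = !col (t.par v)) (x₀ : σ) (hx₀ : κ x₀ = col t.root)
    (p q : W → σ) (hp : ∀ z ∈ Z, κ (p z) = true) (hpq : ∀ z ∈ Z, H.Adj (p z) (q z)) :
    ∃ Φ Ψ : W → σ, (∀ v, H.Adj (Φ v) (Ψ v)) ∧ (∀ v, v ≠ t.root → Φ v = Ψ (t.par v)) ∧
      ∀ v, t.dep (pc v) + L < t.dep v → Φ v = if col v then p (pc v) else q (pc v) := by
  have hZ : ∀ v, pc v ∈ Z := fun v => hP.pc_mem v (mem_univ v)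
  choose step hstep using fun v => exists_step H hH (hpq (pc v) (hZ v))
  let Φ : W → σ := t.fold x₀ step
  have hΦ : ∀ v, v ≠ t.root → Φ v = step (t.par v) (Φ (t.par v)) :=
    fun v hv => t.fold_of_ne x₀ step hv
  have hΦκ : ∀ v, κ (Φ v) = col v := by
    refine t.induct ?_ fun v hv ih => ?_
    · simp only [Φ, t.fold_root, hx₀]
    · rw [hΦ v hv, hκ _ _ (hstep (t.par v) (Φ (t.par v))).1, ih, hcol v hv]
  -- Each level of a piece gains one step towards `p`; the value 1 accounts for the alternation with
  -- `q`.
  have hclose : ∀ v, H.dist (Φ v) (p (pc v)) ≤ max 1 (L + t.dep (pc v) - t.dep v) := by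
    refine t.induct ?_ fun v hv ih => ?_
    · rw [hP.pc_self _ hP.root_mem, Nat.add_sub_cancel]
      exact (hdist _ _).trans (le_max_right _ _)
    · by_cases hz : v ∈ Z
      · rw [hP.pc_self _ hz, Nat.add_sub_cancel]
        exact (hdist _ _).trans (le_max_right _ _)
      · rw [← hP.pc_par v (mem_univ v) hz] at ih
        have hd := t.dep_par v hv
        rw [hΦ v hv]
        obtain ⟨h1, h2, h3⟩ := hstep (t.par v) (Φ (t.par v))
        rw [← hP.pc_par v (mem_univ v) hz] at h2 h3
        by_cases he : Φ (t.par v) = p (pc v)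
        · rw [h2 he, SimpleGraph.dist_comm, SimpleGraph.dist_eq_one_iff_adj.2 (hpq _ (hZ v))]
          exact le_max_left _ _
        · have := h3 he
          omega
  refine ⟨Φ, fun v => step v (Φ v), fun v => (hstep v (Φ v)).1, hΦ, fun v hv => ?_⟩
  have hz : v ∉ Z := fun hz => by rw [hP.pc_self v hz] at hv; omega
  have hr := hP.ne_root hz
  have hd := t.dep_par v hr
  have h0 := hclose (t.par v)
  obtain ⟨h1, h2, h3⟩ := hstep (t.par v) (Φ (t.par v))
  rw [← hP.pc_par v (mem_univ v) hz] at h0 h2 h3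
  rw [← hΦ v hr] at h2 h3
  have hpv := hp _ (hZ v)
  have hqv := hκ _ _ (hpq _ (hZ v))
  have hv' := hΦκ v
  -- Beyond depth `L` the image is an end of the prescribed edge; the bipartition `κ` decides which
  -- end.
  by_cases he : Φ (t.par v) = p (pc v)
  · have h4 := h2 he
    rw [h4, hqv, hpv] at hv'
    simp [h4, ← hv']
  · have h4 : Φ v = p (pc v) := by
      rw [← hH.dist_eq_zero_iff]
      have := h3 he
      omega
    rw [h4, hpv] at hv'
    simp [h4, ← hv']

variable {ι : Type*} (R : SimpleGraph ι) (c : ι)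

/-- The pairs of a vertex and a parity for which there is a short walk of this parity to `c`. -/
abbrev NearState (r : ℕ) : Type _ :=
  {x : ι × Bool // ∃ w : R.Walk x.1 c, w.length ≤ r ∧ (Even w.length ↔ x.2 = true)}

/-- The bipartite double cover of `R` near `c`. -/
def nearDoubleCover (r : ℕ) : SimpleGraph (NearState R c r) where
  Adj x y := R.Adj x.1.1 y.1.1 ∧ y.1.2 = !x.1.2
  symm := ⟨fun x y h => ⟨h.1.symm, by rw [h.2, Bool.not_not]⟩⟩
  loopless := ⟨fun _ h => h.1.ne rfl⟩

variable {R c} {r : ℕ}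

/-- The remaining part of `w` witnesses that each vertex on it, with the right parity, belongs to
the double cover, so `w` lifts. -/
lemma nearDoubleCover_exists_walk {x : ι} (w : R.Walk x c) (o : Bool) (hw : w.length ≤ r)
    (ho : Even w.length ↔ o = true) (hc : ∃ w : R.Walk c c, w.length ≤ r ∧ (Even w.length ↔ true)) :
    ∃ w' : (nearDoubleCover R c r).Walk ⟨(x, o), w, hw, ho⟩ ⟨(c, true), hc⟩,
      w'.length = w.length := by
  induction w generalizing o with
  | nil =>
    have : o = true := ho.1 (by simp)
    subst this
    exact ⟨.nil, rfl⟩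
  | @cons u v c h w ih =>
    have hw2 := hw
    have ho2 : Even w.length ↔ (!o) = true := by
      rw [SimpleGraph.Walk.length_cons, Nat.even_add_one] at ho
      cases o <;> simp_all
    rw [SimpleGraph.Walk.length_cons] at hw2
    obtain ⟨w', hw'⟩ := ih (!o) (by omega) ho2 hc
    exact ⟨SimpleGraph.Walk.cons (G := nearDoubleCover R c r)
      (v := ⟨(v, !o), w, by omega, ho2⟩) ⟨h, rfl⟩ w', congrArg (· + 1) hw'⟩

lemma nearDoubleCover_connected_and_dist_le :
    (nearDoubleCover R c r).Connected ∧ ∀ x y, (nearDoubleCover R c r).dist x y ≤ r + r := by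
  let y : NearState R c r := ⟨(c, true), .nil, by simp, by simp⟩
  have h : ∀ x x', ∃ w : (nearDoubleCover R c r).Walk x x', w.length ≤ r + r := by
    intro x x'
    obtain ⟨⟨x, o⟩, v, hv, ho⟩ := x
    obtain ⟨⟨x', o'⟩, v', hv', ho'⟩ := x'
    obtain ⟨w, hw⟩ := nearDoubleCover_exists_walk v o hv ho y.2
    obtain ⟨w', hw'⟩ := nearDoubleCover_exists_walk v' o' hv' ho' y.2
    refine ⟨w.append w'.reverse, ?_⟩
    rw [SimpleGraph.Walk.length_append, SimpleGraph.Walk.length_reverse]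
    omega
  refine ⟨(SimpleGraph.connected_iff _).2 ⟨fun x x' => (h x x').choose.reachable, ⟨y⟩⟩,
    fun x x' => ?_⟩
  obtain ⟨w, hw⟩ := h x x'
  exact (SimpleGraph.dist_le w).trans hw

/-- A homomorphism of a rooted tree to `R`, which maps all vertices of a piece, except those close
to the root of the piece, to the ends of a prescribed edge near `c`. -/
lemma exists_routing_of_near [Fintype W] [DecidableEq W] {t : RootedTree W} {Z : Finset W}
    {pc : W → W} (hP : t.IsPieces univ Z pc) (col : W → Bool)
    (hcol : ∀ v, v ≠ t.root → col v = !col (t.par v)) (τ : W → ι × ι)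
    (hτ : ∀ z ∈ Z, R.Adj (τ z).1 (τ z).2)
    (hnear : ∀ z ∈ Z, ∃ w : R.Walk (τ z).1 c, Even w.length ∧ w.length + 1 ≤ r) :
    ∃ φ ψ : W → ι, (∀ v, R.Adj (φ v) (ψ v)) ∧ (∀ v, v ≠ t.root → φ v = ψ (t.par v)) ∧
      ∀ v, t.dep (pc v) + 2 * r < t.dep v →
        φ v = if col v then (τ (pc v)).1 else (τ (pc v)).2 := by
  classical
  obtain ⟨hconn, hdist⟩ := nearDoubleCover_connected_and_dist_le (R := R) (c := c) (r := r)
  -- An even walk from the first end to `c`, prolonged by the edge, is an odd walk from the second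
  -- end. Outside `Z` the value is arbitrary.
  have hex : ∀ z : W, ∃ pq : NearState R c r × NearState R c r, z ∈ Z →
      pq.1.1 = ((τ z).1, true) ∧ pq.2.1 = ((τ z).2, false) := by
    intro z
    by_cases hz : z ∈ Z
    · obtain ⟨w, hw, hwr⟩ := hnear z hz
      refine ⟨(⟨((τ z).1, true), w, by omega, by simpa using hw⟩,
        ⟨((τ z).2, false), .cons (hτ z hz).symm w, by simpa using hwr, ?_⟩),
        fun _ => ⟨rfl, rfl⟩⟩
      simp only [SimpleGraph.Walk.length_cons, Bool.false_eq_true, iff_false]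
      rw [Nat.even_add_one, not_not]
      exact hw
    · exact ⟨(⟨(c, true), .nil, by simp, by simp⟩, ⟨(c, true), .nil, by simp, by simp⟩),
        fun h => absurd h hz⟩
  choose pq hpq using hex
  have hroot := hpq t.root hP.root_mem
  have hr : 0 < r := by
    obtain ⟨w, -, hw⟩ := hnear t.root hP.root_mem
    omega
  obtain ⟨Φ, Ψ, h1, h2, h3⟩ := exists_routing (nearDoubleCover R c r) hconn (L := r + r)
    (by omega) hdist (fun x => x.1.2) (fun x y h => h.2) hP col hcol
    (if col t.root then (pq t.root).1 else (pq t.root).2)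
    (by cases col t.root <;> simp [hroot.1, hroot.2]) (fun z => (pq z).1) (fun z => (pq z).2)
    (fun z hz => by simp [(hpq z hz).1])
    (fun z hz => by
      refine ⟨?_, ?_⟩
      · rw [(hpq z hz).1, (hpq z hz).2]; exact hτ z hz
      · rw [(hpq z hz).1, (hpq z hz).2]; rfl)
  refine ⟨fun v => (Φ v).1.1, fun v => (Ψ v).1.1, fun v => (h1 v).1, fun v hv => ?_,
    fun v hv => ?_⟩
  · simp only [h2 v hv]
  · have hz := hpq (pc v) (hP.pc_mem v (mem_univ v))
    simp only [h3 v (by omega)]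
    cases col v <;> simp [hz.1, hz.2]

end Routing

/-! ### Embedding the tree along a homomorphism to the reduced graph. -/

section Embedding

variable {V ι W : Type*} [DecidableEq V]

lemma exists_mem_avoiding {A B₁ B₂ B₃ : Finset V} (h : #B₁ + #B₂ + #B₃ < #A) :
    ∃ x ∈ A, x ∉ B₁ ∧ x ∉ B₂ ∧ x ∉ B₃ := by
  have h1 : #(B₁ ∪ B₂ ∪ B₃) < #A :=
    (card_union_le _ _).trans_lt ((Nat.add_le_add_right (card_union_le _ _) _).trans_lt h)
  obtain ⟨x, hx, hxB⟩ := exists_mem_notMem_of_card_lt_card h1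
  simp only [mem_union, not_or] at hxB
  exact ⟨x, hx, hxB.1.1, hxB.1.2, hxB.2⟩

variable (G : SimpleGraph V) [DecidableRel G.Adj] (R : SimpleGraph ι) (Cl : ι → Finset V)

/-- The part of regularity that is used to embed trees: for adjacent clusters `i` and `j` and every
`Y` in the cluster `j` with at least `u` vertices, all but `e` vertices of the cluster `i` have at
least `g` neighbours in `Y`. -/
def IsTypical (u g e : ℕ) : Prop :=
  ∀ i j, R.Adj i j → ∀ Y ⊆ Cl j, u ≤ #Y → #{x ∈ Cl i | #{y ∈ Y | G.Adj x y} < g} ≤ e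

variable {G R Cl} [DecidableEq W] {u g e s : ℕ}

/-- Embedding of a small piece of a tree, whose root has been embedded, into a set `U` of free
vertices such that all its vertices have many neighbours in a reserved set `S`. -/
lemma exists_embedding_piece (hreg : IsTypical G R Cl u g e) {t : RootedTree W} {φ ψ : W → ι}
    (hφψ : ∀ v, R.Adj (φ v) (ψ v)) (hφ : ∀ v, v ≠ t.root → φ v = ψ (t.par v)) {U S : Finset V}
    (hU : ∀ i, u ≤ #(Cl i ∩ U)) (hS : ∀ i, u ≤ #(Cl i ∩ S)) (hg : 2 * e + s < g) {z : W} {x₀ : V}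
    (hx₀ : x₀ ∈ Cl (φ z) ∧ g ≤ #{y ∈ Cl (ψ z) ∩ U | G.Adj x₀ y} ∧
      g ≤ #{y ∈ Cl (ψ z) ∩ S | G.Adj x₀ y}) (n : ℕ) :
    ∀ K : Finset W, #K = n → #K ≤ s → z ∈ K →
    (∀ v ∈ K, v ≠ z → v ≠ t.root ∧ t.par v ∈ K) →
    ∃ f : W → V, f z = x₀ ∧
      (∀ v ∈ K, f v ∈ Cl (φ v) ∧ g ≤ #{y ∈ Cl (ψ v) ∩ U | G.Adj (f v) y} ∧
        g ≤ #{y ∈ Cl (ψ v) ∩ S | G.Adj (f v) y}) ∧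
      (∀ v ∈ K, v ≠ z → f v ∈ U ∧ G.Adj (f (t.par v)) (f v)) ∧
      ∀ v ∈ K, v ≠ z → ∀ w ∈ K, w ≠ z → f v = f w → v = w := by
  induction n with
  | zero =>
    intro K hK _ hz
    rw [card_eq_zero.1 hK] at hz
    simp at hz
  | succ n ih =>
    intro K hKn hKs hz hK
    rcases (K.erase z).eq_empty_or_nonempty with h0 | hne
    · have hKz : ∀ v ∈ K, v = z := by
        intro v hv
        by_contra h
        have : v ∈ K.erase z := mem_erase.2 ⟨h, hv⟩
        simp [h0] at this
      refine ⟨fun _ => x₀, rfl, fun v hv => hKz v hv ▸ hx₀, fun v hv h => absurd (hKz v hv) h,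
        fun v hv h => absurd (hKz v hv) h⟩
    -- A deepest vertex has no child in `K`, so it can be embedded last.
    · obtain ⟨v, hv, hmax⟩ := exists_max_image _ t.dep hne
      obtain ⟨hvz, hvK⟩ := mem_erase.1 hv
      obtain ⟨hvr, hvp⟩ := hK v hvK hvz
      have hcard := card_erase_add_one hvK
      have hparne : ∀ w ∈ K, w ≠ z → t.par w ≠ v := by
        rintro w hw hwz rfl
        have h1 := hmax w (mem_erase.2 ⟨hwz, hw⟩)
        have h2 := t.dep_par w (hK w hw hwz).1
        omega
      obtain ⟨f, hfz, hf, hfU, hinj⟩ := ih (K.erase v) (by omega) (by omega)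
        (mem_erase.2 ⟨Ne.symm hvz, hz⟩) fun w hw hwz => by
          rw [mem_erase] at hw
          exact ⟨(hK w hw.2 hwz).1, mem_erase.2 ⟨hparne w hw.2 hwz, (hK w hw.2 hwz).2⟩⟩
      have hpK : t.par v ∈ K.erase v := mem_erase.2 ⟨hparne v hvK hvz, hvp⟩
      have hcand := (hf _ hpK).2.1
      rw [← hφ v hvr] at hcand
      have h1 := hreg _ _ (hφψ v) (Cl (ψ v) ∩ U) inter_subset_left (hU _)
      have h2 := hreg _ _ (hφψ v) (Cl (ψ v) ∩ S) inter_subset_left (hS _)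
      have h3 : #((K.erase v).image f) ≤ #(K.erase v) := card_image_le
      -- Of at least `g` free neighbours of the parent's image, at most `s` are used by this piece
      -- and at most `2 * e` are atypical towards `U` or `S`.
      obtain ⟨x, hx, hx1, hx2, hx3⟩ := exists_mem_avoiding (lt_of_lt_of_le (by omega) hcand)
        (B₁ := (K.erase v).image f)
        (B₂ := {x ∈ Cl (φ v) | #{y ∈ Cl (ψ v) ∩ U | G.Adj x y} < g})
        (B₃ := {x ∈ Cl (φ v) | #{y ∈ Cl (ψ v) ∩ S | G.Adj x y} < g})
      simp only [mem_filter, mem_inter] at hx hx2 hx3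
      have hupd : ∀ w ∈ K.erase v, Function.update f v x w = f w := fun w hw =>
        Function.update_of_ne (ne_of_mem_erase hw) _ _
      have hKor : ∀ w ∈ K, w = v ∨ w ∈ K.erase v := fun w hw => by
        by_cases h : w = v
        · exact Or.inl h
        · exact Or.inr (mem_erase.2 ⟨h, hw⟩)
      refine ⟨Function.update f v x, ?_, ?_, ?_, ?_⟩
      · rw [Function.update_of_ne (Ne.symm hvz), hfz]
      · intro w hw
        rcases hKor w hw with rfl | hw
        · rw [Function.update_self]
          refine ⟨hx.1.1, ?_, ?_⟩
          · by_contra! h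
            exact hx2 ⟨hx.1.1, h⟩
          · by_contra! h
            exact hx3 ⟨hx.1.1, h⟩
        · rw [hupd w hw]
          exact hf w hw
      · intro w hw hwz
        rcases hKor w hw with rfl | hw'
        · rw [Function.update_self, hupd _ hpK]
          exact ⟨hx.1.2, hx.2⟩
        · rw [hupd w hw', hupd _ (mem_erase.2 ⟨hparne w hw hwz, (hK w hw hwz).2⟩)]
          exact hfU w hw' hwz
      · intro a ha haz b hb hbz hab
        rcases hKor a ha with rfl | ha <;> rcases hKor b hb with rfl | hb
        · rfl
        · rw [Function.update_self, hupd b hb] at hab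
          exact absurd (mem_image.2 ⟨b, hb, hab.symm⟩) hx1
        · rw [Function.update_self, hupd a ha] at hab
          exact absurd (mem_image.2 ⟨a, ha, hab⟩) hx1
        · rw [hupd a ha, hupd b hb] at hab
          exact hinj a ha haz b hb hbz hab

variable [Fintype V] [Fintype W]

/-- Embedding of a tree along a homomorphism `φ` to the reduced graph which maps all children of a
vertex `v` to the same cluster `ψ v`. The roots of the pieces are embedded into a reserved set. -/
lemma exists_embedding (hreg : IsTypical G R Cl u g e)
    (hCl : ∀ i j, ∀ x ∈ Cl i, x ∈ Cl j → i = j) {t : RootedTree W} {Z : Finset W}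
    {pc : W → W} (hP : t.IsPieces univ Z pc) (hpc : ∀ z, #{v | pc v = z} ≤ s) {φ ψ : W → ι}
    (hφψ : ∀ v, R.Adj (φ v) (ψ v)) (hφ : ∀ v, v ≠ t.root → φ v = ψ (t.par v)) {S : Finset V}
    (hS : ∀ i, u ≤ #(Cl i ∩ S)) [DecidableEq ι] (hcap : ∀ i, u + #{v | φ v = i} ≤ #(Cl i \ S))
    (hg : 2 * e + s < g) (hgZ : 2 * e + #Z < g) (hgu : g ≤ u) :
    ∃ f : W → V, Function.Injective f ∧ ∀ v, v ≠ t.root → G.Adj (f (t.par v)) (f v) := by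
  have hpcpc : ∀ v, v ∉ Z → pc (t.par v) = pc v := fun v hv =>
    (hP.pc_par v (mem_univ v) hv).symm
  -- Pieces are added in order of the depth of their roots. The invariants are that images keep `g`
  -- neighbours in `S`, and that exactly the roots of pieces lie in `S`.
  have key : ∀ n, ∀ D ⊆ Z, #D = n → (∀ z ∈ D, z ≠ t.root → pc (t.par z) ∈ D) →
      ∃ f : W → V,
        (∀ v, pc v ∈ D → f v ∈ Cl (φ v) ∧ g ≤ #{y ∈ Cl (ψ v) ∩ S | G.Adj (f v) y}) ∧
        (∀ v, pc v ∈ D → (f v ∈ S ↔ v ∈ Z)) ∧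
        (∀ v, pc v ∈ D → v ≠ t.root → G.Adj (f (t.par v)) (f v)) ∧
        ∀ v w, pc v ∈ D → pc w ∈ D → f v = f w → v = w := by
    intro n
    induction n with
    | zero =>
      intro D _ hD _
      rw [card_eq_zero.1 hD]
      have hne : (Cl (φ t.root) ∩ S).Nonempty := by
        have := hS (φ t.root)
        rw [← card_pos]
        omega
      exact ⟨fun _ => hne.choose, by simp⟩
    | succ n ih =>
      intro D hDZ hDn hD
      obtain ⟨z, hz, hmax⟩ := exists_max_image D t.dep (card_pos.1 (by omega))
      have hzZ := hDZ hz
      have hpar : ∀ w ∈ D, w ≠ t.root → pc (t.par w) ∈ D.erase z := by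
        intro w hw hwr
        refine mem_erase.2 ⟨fun h => ?_, hD w hw hwr⟩
        have h1 := hP.dep_pc_le (t.par w)
        have h2 := t.dep_par w hwr
        have h3 := hmax w hw
        rw [h] at h1
        omega
      have hcard := card_erase_add_one hz
      obtain ⟨f, hf, hfS, hadj, hinj⟩ := ih (D.erase z) ((erase_subset _ _).trans hDZ) (by omega)
        fun w hw => hpar w (mem_of_mem_erase hw)
      let used : Finset V := ({v | pc v ∈ D.erase z} : Finset W).image f
      have hused : ∀ v, pc v ∈ D.erase z → f v ∈ used := fun v hv =>
        mem_image.2 ⟨v, by simpa using hv, rfl⟩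
      let U : Finset V := univ \ (S ∪ used)
      -- A cluster receives only vertices that `φ` maps to it, so `hcap` leaves `u` free vertices
      -- outside `S`.
      have hU : ∀ i, u ≤ #(Cl i ∩ U) := by
        intro i
        have hsub : (Cl i \ S) \ (({v | φ v = i} : Finset W).image f) ⊆ Cl i ∩ U := by
          intro x hx
          simp only [mem_sdiff, mem_image, mem_filter, mem_univ, true_and, not_exists,
            not_and] at hx
          obtain ⟨⟨hxi, hxS⟩, hx⟩ := hx
          simp only [U, used, mem_inter, mem_sdiff, mem_union, mem_univ, true_and,
            mem_image, mem_filter, not_or, not_exists, not_and]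
          refine ⟨hxi, hxS, ?_⟩
          · rintro v hv rfl
            exact hx v (hCl _ _ _ (hf v hv).1 hxi) rfl
        have h1 := card_le_card hsub
        have h2 := le_card_sdiff (({v | φ v = i} : Finset W).image f) (Cl i \ S)
        have h3 : #(({v | φ v = i} : Finset W).image f) ≤ #({v | φ v = i} : Finset W) :=
          card_image_le
        have h4 := hcap i
        omega
      have hroots : #((D.erase z).image f) ≤ #Z :=
        card_image_le.trans (card_le_card ((erase_subset _ _).trans hDZ))
      have h1 := hreg _ _ (hφψ z) (Cl (ψ z) ∩ U) inter_subset_left (hU _)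
      have h2 := hreg _ _ (hφψ z) (Cl (ψ z) ∩ S) inter_subset_left (hS _)
      -- The candidates for `z` are the neighbours in `S` kept by its parent's image. Only other
      -- roots occupy `S`, so at most `#Z` of them are taken.
      obtain ⟨A, hA, hAg⟩ : ∃ A : Finset V, (∀ x ∈ A, x ∈ Cl (φ z) ∧ x ∈ S ∧
          (z ≠ t.root → G.Adj (f (t.par z)) x)) ∧ g ≤ #A := by
        by_cases hzr : z = t.root
        · refine ⟨Cl (φ z) ∩ S, fun x hx => ?_, hgu.trans (hS _)⟩
          rw [mem_inter] at hx
          exact ⟨hx.1, hx.2, fun h => absurd hzr h⟩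
        · have h := (hf _ (hpar z hz hzr)).2
          rw [← hφ z hzr] at h
          refine ⟨_, fun x hx => ?_, h⟩
          rw [mem_filter, mem_inter] at hx
          exact ⟨hx.1.1, hx.1.2, fun _ => hx.2⟩
      obtain ⟨x, hx, hx1, hx2, hx3⟩ := exists_mem_avoiding (lt_of_lt_of_le (by omega) hAg)
        (B₁ := (D.erase z).image f)
        (B₂ := {x ∈ Cl (φ z) | #{y ∈ Cl (ψ z) ∩ U | G.Adj x y} < g})
        (B₃ := {x ∈ Cl (φ z) | #{y ∈ Cl (ψ z) ∩ S | G.Adj x y} < g})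
      obtain ⟨hxC, hxS, hxadj⟩ := hA x hx
      simp only [mem_filter, hxC, true_and, not_lt] at hx2 hx3
      have hpcz : pc z = z := hP.pc_self z hzZ
      obtain ⟨f', hfz, hf', hfU, hinj'⟩ := exists_embedding_piece hreg hφψ hφ hU hS hg
        (z := z) ⟨hxC, hx2, hx3⟩ _ ({v | pc v = z}) rfl (hpc z) (by simpa using hpcz)
        (by
          intro v hv hvz
          simp only [mem_filter, mem_univ, true_and] at hv ⊢
          have hvZ : v ∉ Z := fun h => hvz (by rw [← hv, hP.pc_self v h])
          exact ⟨hP.ne_root hvZ, by rw [hpcpc v hvZ, hv]⟩)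
      simp only [mem_filter, mem_univ, true_and] at hf' hfU hinj'
      have hUS : ∀ y ∈ U, y ∉ S ∧ y ∉ used := by
        intro y hy
        simpa [U] using hy
      have hDor : ∀ v, pc v ∈ D → pc v = z ∨ (pc v ≠ z ∧ pc v ∈ D.erase z) := fun v hv => by
        by_cases h : pc v = z
        · exact Or.inl h
        · exact Or.inr ⟨h, mem_erase.2 ⟨h, hv⟩⟩
      have hnew : ∀ v, pc v = z → (f' v ∈ S ↔ v ∈ Z) := by
        intro v hv
        by_cases hvz : v = z
        · rw [hvz, hfz]
          exact ⟨fun _ => hzZ, fun _ => hxS⟩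
        · refine ⟨fun h => absurd h (hUS _ (hfU v hv hvz).1).1, fun h => ?_⟩
          exact absurd (by rw [← hv, hP.pc_self v h]) hvz
      have hcross : ∀ v w, pc v = z → pc w ∈ D.erase z → f' v ≠ f w := by
        intro v w hv hw hvw
        by_cases hvz : v = z
        · rw [hvz, hfz] at hvw
          have hwZ := (hfS w hw).1 (hvw ▸ hxS)
          rw [hP.pc_self w hwZ] at hw
          exact hx1 (mem_image.2 ⟨w, hw, hvw.symm⟩)
        · exact (hUS _ (hfU v hv hvz).1).2 (hvw ▸ hused w hw)
      refine ⟨fun v => if pc v = z then f' v else f v, ?_, ?_, ?_, ?_⟩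
      · intro v hv
        rcases hDor v hv with h | ⟨h, h'⟩
        · simp only [h, if_true]
          exact ⟨(hf' v h).1, (hf' v h).2.2⟩
        · simp only [h, if_false]
          exact hf v h'
      · intro v hv
        rcases hDor v hv with h | ⟨h, h'⟩
        · simp only [h, if_true]
          exact hnew v h
        · simp only [h, if_false]
          exact hfS v h'
      · intro v hv hvr
        rcases hDor v hv with h | ⟨h, h'⟩
        · by_cases hvz : v = z
          · subst hvz
            have := hpar v hz hvr
            rw [mem_erase] at this
            simp only [this.1, h, if_true, if_false, hfz]
            exact hxadj hvr
          · have hvZ : v ∉ Z := fun hZ => hvz (by rw [← h, hP.pc_self v hZ])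
            simp only [hpcpc v hvZ, h, if_true]
            exact (hfU v h hvz).2
        · by_cases hvZ : v ∈ Z
          · rw [hP.pc_self v hvZ] at h'
            have := hpar v (mem_of_mem_erase h') hvr
            rw [mem_erase] at this
            simp only [this.1, h, if_false]
            exact hadj v (by rwa [hP.pc_self v hvZ]) hvr
          · simp only [hpcpc v hvZ, h, if_false]
            exact hadj v h' hvr
      · intro v w hv hw hvw
        rcases hDor v hv with h | ⟨h, h'⟩ <;> rcases hDor w hw with k | ⟨k, k'⟩ <;>
          simp only [h, k, if_true, if_false] at hvw
        · by_cases hvz : v = z <;> by_cases hwz : w = z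
          · rw [hvz, hwz]
          · rw [hvz, hfz] at hvw
            exact absurd hxS (hvw ▸ (hUS _ (hfU w k hwz).1).1)
          · rw [hwz, hfz] at hvw
            exact absurd hxS (hvw ▸ (hUS _ (hfU v h hvz).1).1)
          · exact hinj' v h hvz w k hwz hvw
        · exact absurd hvw (hcross v w h k')
        · exact absurd hvw.symm (hcross w v k h')
        · exact hinj v w h' k' hvw
  obtain ⟨f, -, -, hadj, hinj⟩ := key _ Z subset_rfl rfl fun z _ _ => hP.pc_mem _ (mem_univ _)
  have hZ : ∀ v, pc v ∈ Z := fun v => hP.pc_mem v (mem_univ v)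
  exact ⟨f, fun v w h => hinj v w (hZ v) (hZ w) h, fun v hv => hadj v (hZ v) hv⟩

end Embedding

/-! ### A homomorphism to the reduced graph with balanced loads. -/

section Homomorphism

variable {ι W : Type*} [Fintype W] [DecidableEq W]

lemma sum_card_pieces {Z : Finset W} {pc : W → W} (hpc : ∀ v, pc v ∈ Z) (p : W → Prop)
    [DecidablePred p] : ∑ z ∈ Z, #{v | pc v = z ∧ p v} = #{v | p v} := by
  rw [card_eq_sum_card_fiberwise (f := pc) (t := Z) fun v _ => hpc v]
  refine sum_congr rfl fun z _ => congrArg card ?_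
  ext v
  simp [and_comm]

lemma sum_card_pieces_ite [DecidableEq ι] {Z : Finset W} {pc : W → W} (hpc : ∀ v, pc v ∈ Z)
    (p : W → Prop) [DecidablePred p] (f : W → ι) (i : ι) :
    ∑ z ∈ Z, (if f z = i then #{v | pc v = z ∧ p v} else 0) = #{v | p v ∧ f (pc v) = i} := by
  rw [← sum_card_pieces hpc]
  refine sum_congr rfl fun z _ => ?_
  split_ifs with h
  · refine congrArg card ?_
    ext v
    simp only [mem_filter, mem_univ, true_and]
    exact ⟨fun hv => ⟨hv.1, hv.2, hv.1 ▸ h⟩, fun hv => ⟨hv.1, hv.2.1⟩⟩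
  · symm
    rw [card_eq_zero, filter_eq_empty_iff]
    rintro v - ⟨rfl, -, hv⟩
    exact h hv

/-- The two-colouring of a rooted tree whose second class is the smaller one. -/
lemma RootedTree.exists_col (t : RootedTree W) :
    ∃ col : W → Bool, (∀ v, v ≠ t.root → col v = !col (t.par v)) ∧
      2 * #{v | ¬ col v = true} ≤ Fintype.card W := by
  let col : W → Bool := fun v => decide (t.dep v % 2 = 0)
  have hcol : ∀ v, v ≠ t.root → col v = !col (t.par v) := by
    intro v hv
    have := t.dep_par v hv
    simp only [col, ← decide_not, decide_eq_decide]
    omega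
  have hsum := card_filter_add_card_filter_not (s := (univ : Finset W)) (fun v => col v = true)
  rw [card_univ] at hsum
  by_cases h : #{v | ¬ col v = true} ≤ #{v | col v = true}
  · exact ⟨col, hcol, by omega⟩
  · refine ⟨fun v => !col v, fun v hv => by simp [hcol v hv], ?_⟩
    have : #{v | ¬ (!col v) = true} = #{v | col v = true} := by
      congr 1
      ext v
      simp
    simp only
    omega

/-- A homomorphism of a tree to the reduced graph with balanced loads. -/
lemma exists_balanced_hom [Fintype ι] [DecidableEq ι] {R : SimpleGraph ι} [DecidableRel R.Adj]
    (hR : R.Connected) {q : ℕ} (hdeg : ∀ v, q ≤ 2 * R.degree v) (hq : q ≤ Fintype.card ι) (c : ι)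
    (hc : (∀ x y, R.Adj x y → R.dist c x % 2 ≠ R.dist c y % 2) →
      q ≤ #{x | R.dist c x % 2 = 0})
    {t : RootedTree W} {Z : Finset W} {pc : W → W} (hP : t.IsPieces univ Z pc) {s m : ℕ}
    (hpc : ∀ z, #{v | pc v = z} ≤ s) (hshallow : #{v | t.dep v ≤ t.dep (pc v) + 44} ≤ s)
    (hW : Fintype.card W < q * (2 * m)) :
    ∃ φ ψ : W → ι, (∀ v, R.Adj (φ v) (ψ v)) ∧ (∀ v, v ≠ t.root → φ v = ψ (t.par v)) ∧
      ∀ i, #{v | φ v = i} ≤ 2 * m + 5 * s := by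
  obtain ⟨col, hcol, hsmall⟩ := t.exists_col
  have hZ : ∀ v, pc v ∈ Z := fun v => hP.pc_mem v (mem_univ v)
  let a : W → ℕ := fun z => #{v | pc v = z ∧ col v = true}
  let b : W → ℕ := fun z => #{v | pc v = z ∧ ¬ col v = true}
  have hab : ∀ z ∈ Z, a z + b z ≤ s := by
    intro z _
    refine le_trans (le_of_eq ?_) (hpc z)
    have := card_filter_add_card_filter_not (s := ({v | pc v = z} : Finset W))
      (fun v => col v = true)
    rw [filter_filter, filter_filter] at this
    exact this
  have hsa : ∑ z ∈ Z, a z = #{v | col v = true} := sum_card_pieces hZ _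
  have hsb : ∑ z ∈ Z, b z = #{v | ¬ col v = true} := sum_card_pieces hZ _
  have hsum := card_filter_add_card_filter_not (s := (univ : Finset W)) (fun v => col v = true)
  rw [card_univ] at hsum
  obtain ⟨τ, hadj, hnear, hload⟩ : ∃ τ : W → ι × ι, (∀ z ∈ Z, R.Adj (τ z).1 (τ z).2) ∧
      (∀ z ∈ Z, ∃ w : R.Walk (τ z).1 c, Even w.length ∧ w.length ≤ 21) ∧
      ∀ x, ∑ z ∈ Z, (if (τ z).1 = x then a z else 0) +
        ∑ z ∈ Z, (if (τ z).2 = x then b z else 0) ≤ 2 * m + 4 * s := by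
    rcases exists_local_structure hR hdeg hq c hc with
      ⟨A, hA, hind, hAw⟩ | ⟨J, f, hJ, hf, hJadj, hJw⟩
    -- The neighbourhoods offer only about `q / 2` clusters, which suffices because `col` puts at
    -- most half of the tree in the second class.
    · obtain ⟨τ, hτ, hload⟩ := exists_allocation_of_isIndep R Z a b (m := 2 * m)
        (d := (q + 1) / 2) A hind hab (fun x _ => by have := hdeg x; omega)
        (by
          rw [hsa]
          have := Nat.mul_le_mul_right (2 * m) hA
          omega)
        (by
          rw [hsb]
          have : q * (2 * m) ≤ 2 * ((q + 1) / 2) * (2 * m) :=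
            Nat.mul_le_mul_right _ (by omega)
          rw [mul_assoc] at this
          omega)
      exact ⟨τ, fun z hz => (hτ z hz).2, fun z hz => hAw _ (hτ z hz).1,
        fun x => (hload x).trans (by omega)⟩
    · obtain ⟨τ, hτ, hload⟩ := exists_allocation_of_injOn Z a b (m := m) J f hf hab
        (by
          rw [sum_add_distrib, hsa, hsb, hsum]
          exact hW.trans_le (Nat.mul_le_mul_right _ hJ))
      refine ⟨τ, fun z hz => ?_, fun z hz => ?_, hload⟩
      · obtain ⟨x, hx, h | h⟩ := hτ z hz
        · rw [h]; exact hJadj x hx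
        · rw [h]; exact (hJadj x hx).symm
      · obtain ⟨x, hx, h | h⟩ := hτ z hz
        · rw [h]; exact (hJw x hx).1
        · rw [h]; exact (hJw x hx).2
  -- The radius 22 is a walk of length 21 plus the prescribed edge. The routing then takes `2 * 22 =
  -- 44` levels.
  obtain ⟨φ, ψ, h1, h2, h3⟩ := exists_routing_of_near (r := 22) hP col hcol τ hadj
    (fun z hz => by
      obtain ⟨w, hw, hw'⟩ := hnear z hz
      exact ⟨w, hw, by omega⟩)
  refine ⟨φ, ψ, h1, h2, fun i => ?_⟩
  -- The levels still being routed may all hit one cluster; they cost the fifth `s`.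
  have hsub : ({v | φ v = i} : Finset W) ⊆
      univ.filter (fun v => t.dep v ≤ t.dep (pc v) + 44) ∪
        (univ.filter (fun v => col v = true ∧ (τ (pc v)).1 = i) ∪
          univ.filter (fun v => ¬ col v = true ∧ (τ (pc v)).2 = i)) := by
    intro v hv
    simp only [mem_filter, mem_univ, true_and, mem_union] at hv ⊢
    by_cases hd : t.dep v ≤ t.dep (pc v) + 44
    · exact Or.inl hd
    · have := h3 v (by omega)
      rw [hv] at this
      by_cases h : col v = true
      · rw [if_pos h] at this
        exact Or.inr (Or.inl ⟨h, this.symm⟩)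
      · rw [if_neg h] at this
        exact Or.inr (Or.inr ⟨h, this.symm⟩)
  have h4 := (card_le_card hsub).trans ((card_union_le _ _).trans
    (Nat.add_le_add_left (card_union_le _ _) _))
  have h5 := hload i
  rw [sum_card_pieces_ite hZ (fun v => col v = true) (fun z => (τ z).1) i,
    sum_card_pieces_ite hZ (fun v => ¬ col v = true) (fun z => (τ z).2) i] at h5
  omega

end Homomorphism

/-! ### Consequences of regularity. -/

section Regularity

variable {V : Type*} [Fintype V] [DecidableEq V] {G : SimpleGraph V} [DecidableRel G.Adj]
  {ε η : ℝ} {P : Finpartition (univ : Finset V)}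

lemma card_interedges_eq_sum (X Y : Finset V) :
    #(G.interedges X Y) = ∑ x ∈ X, #{y ∈ Y | G.Adj x y} := by
  rw [SimpleGraph.interedges_def, card_filter, sum_product]
  simp_rw [card_filter]

/-- More than `e` atypical vertices would form a set `X` large enough for regularity, so its density
to `Y` would exceed `η - ε`, although each of its vertices has fewer than `g ≤ (η - ε) * #Y`
neighbours there. -/
lemma IsRegularPartition.isTypical (hP : IsRegularPartition G ε η P) {m u g e : ℕ}
    (hm : ∀ C ∈ P.parts, #C = m) (hεη : ε ≤ η) (hu : ε * m < u) (hg : (g : ℝ) ≤ (η - ε) * u)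
    (he : ε * m < e + 1) (hu0 : 0 < u) :
    IsTypical G (reducedGraph G η P) (fun C => C.1) u g e := by
  rintro ⟨C, hC⟩ ⟨D, hD⟩ ⟨hne, hd⟩ Y hY hYu
  simp only at hY hd ⊢
  by_contra! hcon
  set X : Finset V := {x ∈ C | #{y ∈ Y | G.Adj x y} < g} with hX
  have hne' : C ≠ D := fun h => hne (Subtype.ext h)
  have hYu' : (u : ℝ) ≤ #Y := by exact_mod_cast hYu
  have hXe : (e : ℝ) + 1 ≤ #X := by exact_mod_cast hcon
  have h := hP.regular C hC D hD hne' X (filter_subset _ _) Y hY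
    (by rw [hm C hC]; linarith) (by rw [hm D hD]; linarith)
  have h1 : η - ε < (G.edgeDensity X Y : ℝ) := by
    have := (abs_lt.1 h).1
    linarith
  have hXpos : (0 : ℝ) < #X := by
    have : 0 < #X := by omega
    exact_mod_cast this
  have hYpos : (0 : ℝ) < #Y := by
    have : 0 < #Y := by omega
    exact_mod_cast this
  have h2 : (G.edgeDensity X Y : ℝ) = #(G.interedges X Y) / (#X * #Y) := by
    rw [SimpleGraph.edgeDensity_def]
    push_cast
    rfl
  rw [h2, lt_div_iff₀ (mul_pos hXpos hYpos), card_interedges_eq_sum] at h1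
  have h3 : ((∑ x ∈ X, #{y ∈ Y | G.Adj x y} : ℕ) : ℝ) ≤ #X * g := by
    have : ∑ x ∈ X, #{y ∈ Y | G.Adj x y} ≤ #X * g := by
      rw [← smul_eq_mul]
      refine sum_le_card_nsmul _ _ _ fun x hx => ?_
      exact (mem_filter.1 hx).2.le
    exact_mod_cast this
  have h4 : (g : ℝ) ≤ (η - ε) * #Y :=
    hg.trans (mul_le_mul_of_nonneg_left hYu' (by linarith))
  have h5 := mul_le_mul_of_nonneg_left h4 hXpos.le
  nlinarith

/-- Clusters are independent and positive densities exceed `η`, so all neighbours of a vertex of `C`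
lie in clusters adjacent to `C`. -/
lemma IsRegularPartition.minDegree_le (hP : IsRegularPartition G ε η P)
    [DecidableRel (reducedGraph G η P).Adj] {m : ℕ} (hm : ∀ C ∈ P.parts, #C = m)
    (C : {C : Finset V // C ∈ P.parts}) :
    G.minDegree ≤ (reducedGraph G η P).degree C * m := by
  obtain ⟨v, hv⟩ := P.nonempty_of_mem_parts C.2
  refine (G.minDegree_le_degree v).trans ?_
  rw [← SimpleGraph.card_neighborFinset_eq_degree, ← SimpleGraph.card_neighborFinset_eq_degree]
  refine le_trans (card_le_card (t := ((reducedGraph G η P).neighborFinset C).biUnion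
    fun D => D.1) fun w hw => ?_) (card_biUnion_le_card_mul _ _ _ fun D _ => (hm D.1 D.2).le)
  rw [SimpleGraph.mem_neighborFinset] at hw
  obtain ⟨D, hD, hwD⟩ := P.exists_mem (mem_univ w)
  have hne : C.1 ≠ D := by
    rintro rfl
    exact hP.indep C.1 C.2 v hv w hwD hw
  rw [mem_biUnion]
  refine ⟨⟨D, hD⟩, ?_, hwD⟩
  rw [SimpleGraph.mem_neighborFinset]
  refine ⟨fun h => hne (congrArg Subtype.val h), ?_⟩
  refine (hP.density C.1 C.2 D hD hne).resolve_right fun h0 => ?_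
  have h2 : (0 : ℝ) < (G.edgeDensity C.1 D : ℝ) := by
    rw [SimpleGraph.edgeDensity_def]
    have h1 : 0 < #(G.interedges C.1 D) := card_pos.2
      ⟨(v, w), (G.mk_mem_interedges_iff).2 ⟨hv, hwD, hw⟩⟩
    have h2 : 0 < #C.1 := card_pos.2 ⟨v, hv⟩
    have h3 : 0 < #D := card_pos.2 ⟨w, hwD⟩
    push_cast
    positivity
  exact h2.ne' h0

/-- A set that meets every part of a partition into parts of size `m` in exactly `u` vertices. -/
lemma exists_transversal {m u : ℕ} (hm : ∀ C ∈ P.parts, #C = m) (hu : u ≤ m) :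
    ∃ S : Finset V, ∀ C ∈ P.parts, #(C ∩ S) = u := by
  have h : ∀ C : {C : Finset V // C ∈ P.parts}, ∃ S ⊆ C.1, #S = u := fun C =>
    exists_subset_card_eq (by rw [hm C.1 C.2]; exact hu)
  choose S hS hSu using h
  refine ⟨univ.biUnion S, fun C hC => ?_⟩
  rw [← hSu ⟨C, hC⟩]
  congr 1
  ext x
  simp only [mem_inter, mem_biUnion, mem_univ, true_and]
  constructor
  · rintro ⟨hx, D, hxD⟩
    have : D = ⟨C, hC⟩ := Subtype.ext (P.eq_of_mem_parts D.2 hC (hS D hxD) hx)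
    rwa [this] at hxD
  · exact fun hx => ⟨hS _ hx, _, hx⟩

end Regularity

/-! ### Bounds from the maximum degree. -/

section Arithmetic

lemma mul_pow_le_of_pow_le {C D k : ℕ} (hC : C ^ 49 ≤ k) (hD : D ^ 49 ≤ k) :
    C * D ^ 48 ≤ k := by
  rcases le_total C D with h | h
  · calc C * D ^ 48 ≤ D * D ^ 48 := by gcongr
      _ = D ^ 49 := by ring
      _ ≤ k := hD
  · calc C * D ^ 48 ≤ C * C ^ 48 := by gcongr
      _ = C ^ 49 := by ring
      _ ≤ k := hC

/-- As `α < 1`, the ceiling is at least 3, and `18 * 3 - 5 = 49`. -/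
lemma pow_le_of_le_rpow {α : ℝ} (hα : 0 < α) (hα1 : α < 1) {k D : ℕ} (hk : 1 ≤ k)
    (h : (D : ℝ) ≤ (k : ℝ) ^ ((1 : ℝ) / ((18 * ⌈2 / α⌉ - 5 : ℤ) : ℝ))) : D ^ 49 ≤ k := by
  have hceil : (3 : ℤ) ≤ ⌈2 / α⌉ := by
    have : (2 : ℤ) < ⌈2 / α⌉ := by
      rw [Int.lt_ceil, lt_div_iff₀ hα]
      push_cast
      linarith
    omega
  have hc : (49 : ℝ) ≤ ((18 * ⌈2 / α⌉ - 5 : ℤ) : ℝ) := by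
    have : (49 : ℤ) ≤ 18 * ⌈2 / α⌉ - 5 := by omega
    exact_mod_cast this
  have hk' : (1 : ℝ) ≤ k := by exact_mod_cast hk
  have h1 : (D : ℝ) ≤ (k : ℝ) ^ ((1 : ℝ) / 49) :=
    h.trans (Real.rpow_le_rpow_of_exponent_le hk' (one_div_le_one_div_of_le (by norm_num) hc))
  have h2 : (D : ℝ) ^ (49 : ℕ) ≤ (k : ℝ) := by
    calc (D : ℝ) ^ (49 : ℕ) ≤ ((k : ℝ) ^ ((1 : ℝ) / 49)) ^ (49 : ℕ) := by gcongr
      _ = (k : ℝ) := by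
        rw [← Real.rpow_natCast, ← Real.rpow_mul (by positivity)]
        norm_num
  exact_mod_cast h2

/-- A decomposition of a tree with small maximum degree into few small pieces. -/
lemma RootedTree.exists_isPieces_small {W : Type*} [Fintype W] [DecidableEq W] (t : RootedTree W)
    {D E s : ℕ} (hD0 : 0 < D) (hD : ∀ u, #(t.children u) ≤ D) (hE : Fintype.card W ≤ E * s)
    (hED : 135 * E ^ 2 * D ^ 48 ≤ Fintype.card W) (hE0 : 0 < E) :
    ∃ Z pc, t.IsPieces univ Z pc ∧ (∀ z, #{v | pc v = z} ≤ s) ∧ #Z ≤ s ∧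
      #{v | t.dep v ≤ t.dep (pc v) + 44} ≤ s := by
  have hs : 135 * E * D ^ 48 ≤ s := by
    refine Nat.le_of_mul_le_mul_left ?_ hE0
    calc E * (135 * E * D ^ 48) = 135 * E ^ 2 * D ^ 48 := by ring
      _ ≤ E * s := hED.trans hE
  have hDs : 2 * D ≤ s := by
    refine le_trans ?_ hs
    calc 2 * D ≤ 135 * E * D := by nlinarith
      _ ≤ 135 * E * D ^ 48 := by
        gcongr
        exact Nat.le_self_pow (by norm_num) D
  -- This threshold makes the upper bound `1 + D * ((s - 1) / D)` at most `s`.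
  obtain ⟨Z, pc, hP, hZ, hsize⟩ := t.exists_isPieces hD ((s - 1) / D)
  have h1 : D * ((s - 1) / D) ≤ s - 1 := Nat.mul_div_le _ _
  have h2 : s - 1 < D * ((s - 1) / D) + D := by
    have := Nat.lt_mul_div_succ (s - 1) hD0
    rwa [mul_add, mul_one] at this
  have h3 : 0 < (s - 1) / D := Nat.div_pos (by omega) hD0
  set s₁ := (s - 1) / D with hs₁
  have hZ3 : #Z ≤ 3 * (E * D) := by
    refine Nat.le_of_mul_le_mul_right ?_ h3
    have h4 : s ≤ 2 * (D * s₁) := by omega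
    calc #Z * s₁ ≤ Fintype.card W + s₁ := hZ
      _ ≤ E * (2 * (D * s₁)) + 1 * s₁ := by
        rw [one_mul]
        gcongr
        exact hE.trans (Nat.mul_le_mul_left _ h4)
      _ ≤ E * (2 * (D * s₁)) + (E * D) * s₁ := by
        gcongr
        exact Nat.mul_pos hE0 hD0
      _ = 3 * (E * D) * s₁ := by ring
  -- At most `3 * E * D` pieces with at most `45 * D ^ 44` shallow vertices each: this gives `135`
  -- and needs only `D ^ 45`.
  have hmain : #Z * ((44 + 1) * D ^ 44) ≤ s := by
    calc _ ≤ 3 * (E * D) * ((44 + 1) * D ^ 44) := by gcongr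
      _ = 135 * E * D ^ 45 := by ring
      _ ≤ 135 * E * D ^ 48 := by
        gcongr
        · norm_num
      _ ≤ s := hs
  refine ⟨Z, pc, hP, fun z => (hsize z).trans (by omega), le_trans ?_ hmain,
    (hP.card_shallow_le hD0 hD 44).trans hmain⟩
  exact Nat.le_mul_of_pos_right _ (by positivity)

end Arithmetic

/-! ### Distance parity in bipartite graphs, and the choice of parameters. -/

/-- The first vertex class of a connected bipartite graph consists of the vertices at even distance
from any of its vertices. -/
lemma mod_two_dist_eq_zero {ι : Type*} {R : SimpleGraph ι} (hR : R.Connected) {A B : Set ι}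
    (hAB : R.IsBipartiteWith A B) {c x : ι} (hc : c ∈ A) (hx : x ∈ A) : R.dist c x % 2 = 0 := by
  have hnot : ∀ y ∈ A, y ∉ B := fun y h1 h2 => Set.disjoint_left.1 hAB.disjoint h1 h2
  have key : ∀ y (w : R.Walk c y), (y ∈ A ∧ w.length % 2 = 0) ∨ (y ∈ B ∧ w.length % 2 = 1) := by
    intro y w
    induction w using SimpleGraph.Walk.concatRec with
    | Hnil => exact Or.inl ⟨hc, rfl⟩
    | Hconcat p h ih =>
      rw [SimpleGraph.Walk.length_concat]
      have hadj := hAB.mem_of_adj h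
      rcases ih hc with ⟨h1, h2⟩ | ⟨h1, h2⟩
      · rcases hadj with h3 | h3
        · exact Or.inr ⟨h3.2, by omega⟩
        · exact absurd h3.1 (hnot _ h1)
      · rcases hadj with h3 | h3
        · exact absurd h1 (hnot _ h3.1)
        · exact Or.inl ⟨h3.2, by omega⟩
  obtain ⟨w, hw⟩ := hR.exists_walk_length_eq_dist c x
  rcases key x w with h | h
  · omega
  · exact absurd h.1 (hnot x hx)

lemma isBipartite_of_dist {ι : Type*} {R : SimpleGraph ι} (c : ι)
    (h : ∀ x y, R.Adj x y → R.dist c x % 2 ≠ R.dist c y % 2) : R.IsBipartite :=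
  ⟨SimpleGraph.Coloring.mk (fun x => (⟨R.dist c x % 2, Nat.mod_lt _ (by norm_num)⟩ : Fin 2))
    fun {x y} hxy he => h x y hxy (by simpa using he)⟩

/-- Numerical parameters for the embedding: clusters have size `m`, the piece size and the number of
atypical vertices are bounded by `s`, the reserved sets have size `u`, typical vertices have at
least `g` neighbours, and `2 * m'` is the capacity of a cluster. -/
lemma exists_parameters {r : ℝ} (hr : 0 < r) (hr1 : r < 1 / 10000) {k m M E : ℕ}
    (hE : 8 * M ≤ r ^ 2 * E) (hM : 1 ≤ M) (hkE : E ≤ k) (hm : (k : ℝ) ≤ 2 * M * m) :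
    ∃ s u g m' : ℕ, k + 1 ≤ E * s ∧ r ^ 2 * m < s + 1 ∧ r ^ 2 * m < u ∧
      (g : ℝ) ≤ (5 * r - r ^ 2) * u ∧ 3 * s < g ∧ g ≤ u ∧ 2 * u + (2 * m' + 5 * s) ≤ m ∧
      ∀ q : ℕ, (1 + 100 * r) * k ≤ q * m → k + 1 < q * (2 * m') := by
  have hM' : (1 : ℝ) ≤ M := by exact_mod_cast hM
  have hkE' : (E : ℝ) ≤ k := by exact_mod_cast hkE
  have hr2 : 0 < r ^ 2 := by positivity
  have hrr : r ^ 2 ≤ r / 10000 := by nlinarith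
  have hk : 8 * (M : ℝ) ≤ r ^ 2 * k := hE.trans (by gcongr)
  have hm4 : 4 ≤ r ^ 2 * m := by
    have h1 : r ^ 2 * k ≤ r ^ 2 * (2 * M * m) := by gcongr
    have h2 : (M : ℝ) * 4 ≤ M * (r ^ 2 * m) := by nlinarith
    exact le_of_mul_le_mul_left h2 (by linarith)
  have hm0 : (0 : ℝ) ≤ m := by positivity
  have hrm : 40000 ≤ r * m := by nlinarith
  have hE1 : (1 : ℝ) ≤ E := by
    have : (0 : ℝ) < E := by
      by_contra! h
      nlinarith
    have : 0 < E := by exact_mod_cast this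
    exact_mod_cast this
  have hs1 := Nat.floor_le (show 0 ≤ r ^ 2 * m by positivity)
  have hs2 := Nat.lt_floor_add_one (r ^ 2 * m)
  have hu1 := Nat.le_ceil (r * m)
  have hu2 := Nat.ceil_lt_add_one (show 0 ≤ r * m by positivity)
  have hg1 := Nat.floor_le (show 0 ≤ 4 * (r ^ 2 * m) by positivity)
  have hg2 := Nat.lt_floor_add_one (4 * (r ^ 2 * m))
  have hp1 := Nat.floor_le (show 0 ≤ (1 - 4 * r) * m / 2 by
    have : 0 ≤ 1 - 4 * r := by linarith
    positivity)
  have hp2 := Nat.lt_floor_add_one ((1 - 4 * r) * m / 2)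
  -- With `r = √ε`: `g ≈ 4εm` lies between `3 * s ≈ 3εm` and the typical degree, about `5εm`, into a
  -- set of size `u ≈ rm`. Of the `4rm` vertices withheld from the capacity, `2rm` cover `2 * u` and
  -- the rest absorbs `5 * s` and rounding.
  refine ⟨⌊r ^ 2 * m⌋₊, ⌈r * m⌉₊, ⌊4 * (r ^ 2 * m)⌋₊, ⌊(1 - 4 * r) * m / 2⌋₊, ?_, hs2, ?_, ?_, ?_,
    ?_, ?_, ?_⟩
  · have h1 : (E : ℝ) * (r ^ 2 * m - 1) ≤ E * ⌊r ^ 2 * m⌋₊ := by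
      gcongr
      linarith
    have h2 : 8 * (M : ℝ) * m ≤ r ^ 2 * E * m := by gcongr
    have h4 : (1 : ℝ) ≤ k := hE1.trans hkE'
    have h3 : ((k + 1 : ℕ) : ℝ) ≤ (E * ⌊r ^ 2 * m⌋₊ : ℕ) := by
      push_cast
      nlinarith
    exact_mod_cast h3
  · nlinarith
  · refine hg1.trans ?_
    calc 4 * (r ^ 2 * m) = 4 * r * (r * m) := by ring
      _ ≤ (5 * r - r ^ 2) * (r * m) := by
        refine mul_le_mul_of_nonneg_right ?_ (by linarith)
        nlinarith
      _ ≤ _ := mul_le_mul_of_nonneg_left hu1 (by nlinarith)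
  · have : ((3 * ⌊r ^ 2 * m⌋₊ : ℕ) : ℝ) < (⌊4 * (r ^ 2 * m)⌋₊ : ℕ) := by
      push_cast
      linarith
    exact_mod_cast this
  · have : ((⌊4 * (r ^ 2 * m)⌋₊ : ℕ) : ℝ) ≤ (⌈r * m⌉₊ : ℕ) := by nlinarith
    exact_mod_cast this
  · have h1 : r ^ 2 * m ≤ r * m / 10000 := by nlinarith
    have : ((2 * ⌈r * m⌉₊ + (2 * ⌊(1 - 4 * r) * m / 2⌋₊ + 5 * ⌊r ^ 2 * m⌋₊) : ℕ) : ℝ) ≤ m := by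
      push_cast
      linarith
    exact_mod_cast this
  · intro q hq
    -- The gain `1 + 100 * r` outweighs the loss `1 - 5 * r`.
    have h1 : (1 - 5 * r) * m ≤ 2 * (⌊(1 - 4 * r) * m / 2⌋₊ : ℝ) := by linarith
    have h2 : (q : ℝ) * ((1 - 5 * r) * m) ≤ q * (2 * (⌊(1 - 4 * r) * m / 2⌋₊ : ℝ)) := by gcongr
    have h3 : (1 - 5 * r) * ((1 + 100 * r) * k) ≤ (1 - 5 * r) * (q * m) :=
      mul_le_mul_of_nonneg_left hq (by linarith)
    have hrk : r ^ 2 * k ≤ r * k / 10000 := by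
      have : (0 : ℝ) ≤ k := by positivity
      nlinarith
    have h4 : ((k + 1 : ℕ) : ℝ) < (q * (2 * ⌊(1 - 4 * r) * m / 2⌋₊) : ℕ) := by
      push_cast
      nlinarith
    exact_mod_cast h4

end TreeEmbedding

/-! ### Proof of the main theorem. -/

open Finset in
theorem proposition5p9 (α ε : ℝ) (hα : (1 : ℝ) / 2 ≤ α) (hα1 : α < 1)
    (hε : 0 < ε) (hε1 : ε < (10 : ℝ)⁻¹ ^ 8) (M₀ : ℕ) :
    ∃ k₀ : ℕ, ∀ k : ℕ, k₀ ≤ k →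
      ∀ (V : Type*) [Fintype V] [DecidableEq V] (G : SimpleGraph V) [DecidableRel G.Adj]
        (P : Finpartition (Finset.univ : Finset V)),
        k₀ ≤ Fintype.card V →
        (1 + 100 * √ε) * α * (k : ℝ) ≤ (G.minDegree : ℝ) →
        TreeEmbedding.IsRegularPartition G ε (5 * √ε) P →
        (TreeEmbedding.reducedGraph G (5 * √ε) P).Connected →
        P.parts.card ≤ M₀ →
        ((∃ A B : Finset {C : Finset V // C ∈ P.parts},
            (TreeEmbedding.reducedGraph G (5 * √ε) P).IsBipartiteWith (A : Set _) (B : Set _) ∧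
            A ∪ B = Finset.univ ∧
            (1 + 100 * √ε) * (k : ℝ) * ((P.parts.card : ℝ) / (Fintype.card V : ℝ))
              ≤ (A.card : ℝ)) ∨
          (¬ (TreeEmbedding.reducedGraph G (5 * √ε) P).IsBipartite ∧
            (1 + 100 * √ε) * (k : ℝ) ≤ (Fintype.card V : ℝ))) →
        ∀ (W : Type*) [Fintype W] (T : SimpleGraph W) [DecidableRel T.Adj],
          T.IsTree → T.edgeSet.ncard = k →
          (T.maxDegree : ℝ) ≤ (k : ℝ) ^ ((1 : ℝ) / ((18 * ⌈2 / α⌉ - 5 : ℤ) : ℝ)) →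
          T.IsContained G := by
  classical
  have hr : 0 < √ε := Real.sqrt_pos.2 hε
  have hr2 : √ε ^ 2 = ε := Real.sq_sqrt hε.le
  have hr1 : √ε < 1 / 10000 := by
    rw [Real.sqrt_lt' (by norm_num)]
    exact hε1.trans_eq (by norm_num)
  -- `E` bounds the ratio of the tree size to `s`, independently of `k`.
  obtain ⟨E, hE⟩ := exists_nat_ge (8 * ((M₀ + 1 : ℕ) : ℝ) / ε)
  have hE' : 8 * ((M₀ + 1 : ℕ) : ℝ) ≤ √ε ^ 2 * E := by
    rw [hr2]
    rw [div_le_iff₀ hε] at hE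
    linarith
  have hE0 : 0 < E := by
    rw [Nat.pos_iff_ne_zero]
    rintro rfl
    rw [Nat.cast_zero, mul_zero] at hE'
    have : (0 : ℝ) < ((M₀ + 1 : ℕ) : ℝ) := by positivity
    linarith
  -- With this value, `D ^ 49 ≤ k` implies `135 * E ^ 2 * D ^ 48 ≤ k`.
  refine ⟨(135 * E ^ 2) ^ 49, fun k hk V _ _ G _ P _ hdeg hP hconn hparts hcase W _ T _ hT hTk
    hTΔ => ?_⟩
  have hkE : E ≤ k := by
    refine le_trans ?_ hk
    calc E ≤ 135 * E ^ 2 := by nlinarith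
      _ ≤ _ := Nat.le_self_pow (by norm_num) _
  set R := TreeEmbedding.reducedGraph G (5 * √ε) P with hR
  obtain ⟨C₀⟩ := hconn.nonempty
  obtain ⟨m, hm⟩ : ∃ m, ∀ C ∈ P.parts, #C = m := ⟨_, fun C hC => hP.card_eq C hC C₀.1 C₀.2⟩
  have hmpos : 0 < m := by
    rw [← hm C₀.1 C₀.2]
    exact card_pos.2 (P.nonempty_of_mem_parts C₀.2)
  have hm' : (0 : ℝ) < m := by exact_mod_cast hmpos
  have hn : Fintype.card V = #P.parts * m := by
    rw [← card_univ, ← P.sum_card_parts, sum_congr rfl hm, sum_const, smul_eq_mul]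
  have hk0 : (0 : ℝ) ≤ k := by positivity
  have hdeg2 : (1 + 100 * √ε) * k ≤ 2 * (G.minDegree : ℝ) := by
    have : (1 + 100 * √ε) * (1 / 2) * (k : ℝ) ≤ (1 + 100 * √ε) * α * k := by gcongr
    linarith
  have hmk : (k : ℝ) ≤ 2 * ((M₀ + 1 : ℕ) : ℝ) * m := by
    obtain ⟨v, -⟩ := P.nonempty_of_mem_parts C₀.2
    have h1 : G.minDegree ≤ (M₀ + 1) * m := by
      refine (G.minDegree_le_degree v).trans ((G.degree_lt_card_verts v).le.trans ?_)
      rw [hn]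
      exact Nat.mul_le_mul_right _ (by omega)
    have h2 : (G.minDegree : ℝ) ≤ ((M₀ + 1 : ℕ) : ℝ) * m := by exact_mod_cast h1
    nlinarith
  obtain ⟨s, u, g, m', hks, hs, hu, hg, hsg, hgu, hum, hq'⟩ :=
    TreeEmbedding.exists_parameters hr hr1 hE' (by omega) hkE hmk
  obtain ⟨q, hq1, hq2⟩ : ∃ q : ℕ, (1 + 100 * √ε) * k ≤ q * m ∧
      ∀ a : ℕ, (1 + 100 * √ε) * k ≤ a * m → q ≤ a := by
    refine ⟨⌈(1 + 100 * √ε) * k / m⌉₊, ?_, fun a ha => ?_⟩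
    · rw [← div_le_iff₀ hm']
      exact Nat.le_ceil _
    · rw [Nat.ceil_le, div_le_iff₀ hm']
      exact ha
  have hRdeg : ∀ C, q ≤ 2 * R.degree C := by
    intro C
    apply hq2
    have h1 : (G.minDegree : ℝ) ≤ (R.degree C : ℝ) * m := by exact_mod_cast hP.minDegree_le hm C
    push_cast
    linarith
  obtain ⟨c, hqc, hc⟩ : ∃ c, q ≤ Fintype.card {C : Finset V // C ∈ P.parts} ∧
      ((∀ x y, R.Adj x y → R.dist c x % 2 ≠ R.dist c y % 2) →
        q ≤ #{x | R.dist c x % 2 = 0}) := by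
    -- In the bipartite case `c` is taken in `A`, so that even distances cover `A`. Otherwise the
    -- condition on parities is vacuous.
    rcases hcase with ⟨A, B, hAB, -, hA⟩ | ⟨hbip, hkn⟩
    · have hparts0 : (#P.parts : ℝ) ≠ 0 := by
        have : 0 < #P.parts := card_pos.2 ⟨C₀.1, C₀.2⟩
        positivity
      have hqA : q ≤ #A := by
        apply hq2
        rw [hn] at hA
        push_cast at hA
        rwa [← div_div, div_self hparts0, mul_one_div, div_le_iff₀ hm'] at hA
      obtain ⟨c, hcA⟩ : A.Nonempty := by
        rw [← card_pos]
        refine lt_of_lt_of_le (Nat.pos_of_ne_zero ?_) hqA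
        rintro rfl
        have := hq' 0 hq1
        omega
      refine ⟨c, hqA.trans (card_le_univ A), fun _ => hqA.trans (card_le_card fun x hx => ?_)⟩
      rw [mem_filter]
      exact ⟨mem_univ x, TreeEmbedding.mod_two_dist_eq_zero hconn hAB hcA hx⟩
    · refine ⟨C₀, ?_, fun h => absurd (TreeEmbedding.isBipartite_of_dist C₀ h) hbip⟩
      apply hq2
      rw [Fintype.card_coe]
      rw [hn] at hkn
      exact_mod_cast hkn
  have hW : Fintype.card W = k + 1 := by
    rw [← hT.card_edgeFinset, ← hTk, Set.ncard_eq_toFinset_card']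
    rfl
  obtain ⟨t, ht1, ht2⟩ := TreeEmbedding.exists_rootedTree hT
  have hk1 : 1 ≤ k := hE0.trans_le hkE
  have hD49 : (max 1 T.maxDegree) ^ 49 ≤ k := by
    rcases max_choice 1 T.maxDegree with h | h
    · rw [h, one_pow]
      exact hk1
    · rw [h]
      exact TreeEmbedding.pow_le_of_le_rpow (by linarith) hα1 hk1 hTΔ
  have hchildren : ∀ v, #(t.children v) ≤ max 1 T.maxDegree := by
    intro v
    refine le_trans (card_le_card (t := T.neighborFinset v) fun w hw => ?_)
      ((T.degree_le_maxDegree v).trans (le_max_right _ _))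
    simp only [TreeEmbedding.RootedTree.children, mem_filter, mem_univ, true_and] at hw
    rw [SimpleGraph.mem_neighborFinset, ← hw.2]
    exact ht1 w hw.1
  obtain ⟨Z, pc, hZ, hpc, hZs, hshallow⟩ := t.exists_isPieces_small (E := E) (s := s)
    (lt_of_lt_of_le one_pos (le_max_left 1 T.maxDegree)) hchildren (by rw [hW]; exact hks)
    (by
      rw [hW]
      exact (TreeEmbedding.mul_pow_le_of_pow_le hk hD49).trans (Nat.le_succ k)) hE0
  obtain ⟨φ, ψ, hφψ, hφ, hload⟩ := TreeEmbedding.exists_balanced_hom hconn hRdeg hqc c hc hZ hpc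
    hshallow (by rw [hW]; exact hq' q hq1)
  obtain ⟨S, hS⟩ := TreeEmbedding.exists_transversal hm (u := u) (by omega)
  rw [hr2] at hs hu hg
  have htyp := hP.isTypical hm (u := u) (g := g) (e := s) (by nlinarith) hu hg hs (by omega)
  obtain ⟨f, hinj, hadj⟩ := TreeEmbedding.exists_embedding htyp
    (fun i j x hi hj => Subtype.ext (P.eq_of_mem_parts i.2 j.2 hi hj)) hZ hpc hφψ hφ (S := S)
    (fun i => (hS i.1 i.2).ge)
    (fun i => by
      have h1 := hload i
      have h2 := card_sdiff_add_card_inter i.1 S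
      rw [hS i.1 i.2, hm i.1 i.2] at h2
      omega)
    (by omega) (by omega) hgu
  refine ⟨⟨⟨f, fun {x y} hxy => ?_⟩, hinj⟩⟩
  rcases ht2 x y hxy with ⟨h1, rfl⟩ | ⟨h1, rfl⟩
  · exact hadj y h1
  · exact (hadj x h1).symm
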